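/- Let $\mathfrak g$ be one of the following 7-dimensional real Lie algebras with basis $(X_1,\dots,X_5,X,Y)$. In each of them $[X_1,X_2]=X_4$, $[X_1,X_3]=X_5$, $[X,Y]=0$; the further nonzero brackets of basis vectors (up to skew-symmetry) are - $\mathfrak g_2$: $[X,X_i]=X_i$ for $i=1,4,5$; $[Y,X_i]=X_i$ for $i=3,5$. - $\mathfrak g_3$: $[X,X_i]=X_i$ for $i=2,4$; $[Y,X_i]=X_i$ for $i=3,5$. - $\mathfrak g_4^{00}$: $[X,X_i]=X_i$ for $i=1,4,5$; $[Y,X_i]=X_i$ for $i=2,4$. - $\mathfrak g_9$: $[X,X_i]=X_i$ for $i=3,5$; $[Y,X_i]=X_i$ for $i=2,4$; $[Y,X_3]=X_5$. - $\mathfrak g_{10}^\lambda$ ($\lambda\in\mathbb R$): $[X,X_i]=X_i$ for $i=2,4$; $[X,X_i]=\lambda X_i$ for $i=3,5$; $[Y,X_3]=X_3+X_5$; $[Y,X_5]=X_5$. Let $G$ be the connected and simply connected Lie group with Lie algebra $\mathfrak g$; write $G=G_2,G_3,G_4^{00},G_9,G_{10}^\lambda$ respectively. Let $G$ act on $\mathfrak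 g^*$ by the coadjoint action $\langle K(g)F,U\rangle=\langle F,\mathrm{Ad}(g^{-1})U\rangle$, and let $\Omega_F=\{K(g)F: g\in G\}$ be the orbit of $F\in\mathfrak g^*$; its dimension is the dimension of its tangent space at $F$, i.e. the rank at the identity of $g\mapsto K(g)F$. Let $(\alpha_1,\dots,\alpha_5,\alpha,\beta)$ be the coordinates of $F$, and $(x_1^*,\dots,x_5^*,x^*,y^*)$ those of a general element of $\mathfrak g^*$, with respect to the dual basis $(X_1^*,\dots,X_5^*,X^*,Y^*)$. **Theorem.** The maximal dimension of the coadjoint orbits of $G$ is exactly $6$. The 6-dimensional orbits are as follows (all coordinates of $F$ that are not restricted are arbitrary). 1. $G=G_2$: $\dim\Omega_F=6$ if and only if $\alpha_4\ne0$ and $\alpha_3^2+\alpha_5^2\neq 0$. - (i) If $\alpha_3\alpha_4\ne0=\alpha_5$, then $\Omega_F=\{x_5^*=0,\ \alpha_3x_3^*>0,\ \alpha_4x_4^*>0\}$. - (ii) If $\alpha_4\alpha_5\ne0$, then $\Omega_F$ is a part of an algebraic hypersurface of degree two: $\Omega_F=\{x_2^*-\frac{x_3^*x_4^*}{x_5^*}=\frac{\alpha_2\alpha_5-\alpha_3\alpha_4}{\alpha_5},\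 \alpha_4x_4^*>0,\ \alpha_5x_5^*>0\}$. 2. $G=G_4^{00}$: $\dim\Omega_F=6$ if and only if $\alpha_5\ne0$ and $\alpha_2^2+\alpha_4^2\neq 0$. - (i) If $\alpha_2\alpha_5\ne0=\alpha_4$, then $\Omega_F=\{x_4^*=0,\ \alpha_2x_2^*>0,\ \alpha_5x_5^*>0\}$. - (ii) If $\alpha_4\alpha_5\ne0$, then $\Omega_F$ is a part of an algebraic hypersurface of degree two: $\Omega_F=\{x_3^*-\frac{x_2^*x_5^*}{x_4^*}=\frac{\alpha_3\alpha_4-\alpha_2\alpha_5}{\alpha_4},\ \alpha_4x_4^*>0,\ \alpha_5x_5^*>0\}$. 3. $G=G_3$, $G_9$ or $G_{10}^\lambda$: $\dim\Omega_F=6$ if and only if either $\alpha_4=0\ne\alpha_2\alpha_5$, or $\alpha_4\ne0$ and $\alpha_3^2+\alpha_5^2\neq 0$. - (i) If $\alpha_4=0\ne\alpha_2\alpha_5$, then $\Omega_F=\{x_4^*=0,\ \alpha_2x_2^*>0,\ \alpha_5x_5^*>0\}$. - (ii) If $\alpha_5=0\ne\alpha_3\alpha_4$, then $\Omega_F=\{x_5^*=0,\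 \alpha_3x_3^*>0,\ \alpha_4x_4^*>0\}$. - (iii) If $\alpha_4\alpha_5\ne0$, then - for $G_3$, $\Omega_F$ is a part of an algebraic hypersurface of degree two: $\Omega_F=\{\frac{x_2^*}{x_4^*}-\frac{x_3^*}{x_5^*}=\frac{\alpha_2}{\alpha_4}-\frac{\alpha_3}{\alpha_5},\ \alpha_4x_4^*>0,\ \alpha_5x_5^*>0\}$; - for $G_9$, $\Omega_F$ is a part of a transcendental hypersurface: $\Omega_F=\{\frac{x_2^*}{x_4^*}-\frac{x_3^*}{x_5^*}+\ln|x_4^*|=\frac{\alpha_2}{\alpha_4}-\frac{\alpha_3}{\alpha_5}+\ln|\alpha_4|,\ \alpha_4x_4^*>0,\ \alpha_5x_5^*>0\}$; - for $G_{10}^\lambda$, $\Omega_F$ is a part of a transcendental hypersurface: $\Omega_F=\{\frac{x_2^*}{x_4^*}-\frac{x_3^*}{x_5^*}+\ln\frac{|x_5^*|}{|x_4^*|^\lambda}=\frac{\alpha_2}{\alpha_4}-\frac{\alpha_3}{\alpha_5}+\ln\frac{|\alpha_5|}{|\alpha_4|^\lambda},\ \alpha_4x_4^*>0,\ \alpha_5x_5^*>0\}$.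 Here a part of an algebraic hypersurface of degree two is a set on which an irreducible real polynomial of degree two in the seven coordinates vanishes; that the hypersurface is transcendental means that no nonzero real polynomial in the seven coordinates vanishes on $\Omega_F$. -/

import Mathlib

open scoped Manifold ContDiff

noncomputable section

/-- Labels of the five families of seven-dimensional Lie algebras:
`G₂`, `G₃`, `G₄⁰⁰`, `G₉` and `G₁₀^lam` with a real parameter `lam`. -/
inductive SolvKind : Type
  | g2 : SolvKind
  | g3 : SolvKind
  | g4 : SolvKind
  | g9 : SolvKind
  | g10 (lam : ℝ) : SolvKind

/-- The matrix `a_X`: row `i` holds the coordinates of `[X, Xᵢ]` in `X₁, …, X₅`. -/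
def matX : SolvKind → Matrix (Fin 5) (Fin 5) ℝ
  | .g2 => Matrix.diagonal ![1, 0, 0, 1, 1]
  | .g3 => Matrix.diagonal ![0, 1, 0, 1, 0]
  | .g4 => Matrix.diagonal ![1, 0, 0, 1, 1]
  | .g9 => Matrix.diagonal ![0, 0, 1, 0, 1]
  | .g10 lam => Matrix.diagonal ![0, 1, lam, 1, lam]

/-- The matrix `a_Y`: row `i` holds the coordinates of `[Y, Xᵢ]` in `X₁, …, X₅`. -/
def matY : SolvKind → Matrix (Fin 5) (Fin 5) ℝ
  | .g2 => Matrix.diagonal ![0, 0, 1, 0, 1]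
  | .g3 => Matrix.diagonal ![0, 0, 1, 0, 1]
  | .g4 => Matrix.diagonal ![0, 1, 0, 1, 0]
  | .g9 => Matrix.diagonal ![0, 1, 0, 1, 0] + Matrix.single 2 4 1
  | .g10 _ => Matrix.diagonal ![0, 0, 1, 0, 1] + Matrix.single 2 4 1

/-- The bracket of the nilradical: `[X₁, X₂] = X₄`, `[X₁, X₃] = X₅`. -/
def nilBracket (u v : Fin 7 → ℝ) : Fin 5 → ℝ :=
  ![0, 0, 0, u 0 * v 1 - u 1 * v 0, u 0 * v 2 - u 2 * v 0]

/-- Component along `X_{j+1}` of the bracket of `u` and `v`, where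
`u = u₀ X₁ + ⋯ + u₄ X₅ + u₅ X + u₆ Y`; here `[X, Y] = 0`. -/
def solvBracketCoord (K : SolvKind) (u v : Fin 7 → ℝ) (j : Fin 5) : ℝ :=
  nilBracket u v j
    + ∑ i : Fin 5, (u 5 * v (Fin.castAdd 2 i) - v 5 * u (Fin.castAdd 2 i)) * matX K i j
    + ∑ i : Fin 5, (u 6 * v (Fin.castAdd 2 i) - v 6 * u (Fin.castAdd 2 i)) * matY K i j

/-- The bracket in the coordinates of the basis `(X₁, …, X₅, X, Y)`. -/
def solvBracket (K : SolvKind) (u v : Fin 7 → ℝ) : Fin 7 → ℝ :=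
  ![solvBracketCoord K u v 0, solvBracketCoord K u v 1, solvBracketCoord K u v 2,
    solvBracketCoord K u v 3, solvBracketCoord K u v 4, 0, 0]

/-- The underlying space `ℝ⁷` of the Lie algebra with label `K`. -/
def SolvLie (_K : SolvKind) : Type := Fin 7 → ℝ

instance instAddCommGroupSolvLie (K : SolvKind) : AddCommGroup (SolvLie K) := inferInstanceAs (AddCommGroup (Fin 7 → ℝ))

instance instModuleSolvLie (K : SolvKind) : Module ℝ (SolvLie K) := inferInstanceAs (Module ℝ (Fin 7 → ℝ))

instance instBracketSolvLie (K : SolvKind) : Bracket (SolvLie K) (SolvLie K) := ⟨solvBracket K⟩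

theorem solvBracket_g2 (u v : Fin 7 → ℝ) :
    solvBracket SolvKind.g2 u v = ![
      u 5 * v 0 - v 5 * u 0,
      0,
      u 6 * v 2 - v 6 * u 2,
      u 0 * v 1 - u 1 * v 0 + (u 5 * v 3 - v 5 * u 3),
      u 0 * v 2 - u 2 * v 0 + (u 5 * v 4 - v 5 * u 4) + (u 6 * v 4 - v 6 * u 4),
      0, 0] := by
  funext k
  fin_cases k <;>
    simp [solvBracket, solvBracketCoord, nilBracket, matX, matY, Matrix.diagonal, Fin.castAdd,
      Fin.castLE]

theorem solvBracket_g3 (u v : Fin 7 → ℝ) :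
    solvBracket SolvKind.g3 u v = ![
      0,
      u 5 * v 1 - v 5 * u 1,
      u 6 * v 2 - v 6 * u 2,
      u 0 * v 1 - u 1 * v 0 + (u 5 * v 3 - v 5 * u 3),
      u 0 * v 2 - u 2 * v 0 + (u 6 * v 4 - v 6 * u 4),
      0, 0] := by
  funext k
  fin_cases k <;>
    simp [solvBracket, solvBracketCoord, nilBracket, matX, matY, Matrix.diagonal, Fin.castAdd,
      Fin.castLE]

theorem solvBracket_g4 (u v : Fin 7 → ℝ) :
    solvBracket SolvKind.g4 u v = ![
      u 5 * v 0 - v 5 * u 0,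
      u 6 * v 1 - v 6 * u 1,
      0,
      u 0 * v 1 - u 1 * v 0 + (u 5 * v 3 - v 5 * u 3) + (u 6 * v 3 - v 6 * u 3),
      u 0 * v 2 - u 2 * v 0 + (u 5 * v 4 - v 5 * u 4),
      0, 0] := by
  funext k
  fin_cases k <;>
    simp [solvBracket, solvBracketCoord, nilBracket, matX, matY, Matrix.diagonal, Fin.castAdd,
      Fin.castLE]

theorem solvBracket_g9 (u v : Fin 7 → ℝ) :
    solvBracket SolvKind.g9 u v = ![
      0,
      u 6 * v 1 - v 6 * u 1,
      u 5 * v 2 - v 5 * u 2,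
      u 0 * v 1 - u 1 * v 0 + (u 6 * v 3 - v 6 * u 3),
      u 0 * v 2 - u 2 * v 0 + (u 5 * v 4 - v 5 * u 4) + (u 6 * v 2 - v 6 * u 2),
      0, 0] := by
  funext k
  fin_cases k <;>
    simp [solvBracket, solvBracketCoord, nilBracket, matX, matY, Fin.sum_univ_five,
      Matrix.diagonal, Matrix.single, Fin.castAdd, Fin.castLE]

theorem solvBracket_g10 (lam : ℝ) (u v : Fin 7 → ℝ) :
    solvBracket (SolvKind.g10 lam) u v = ![
      0,
      u 5 * v 1 - v 5 * u 1,
      (u 5 * v 2 - v 5 * u 2) * lam + (u 6 * v 2 - v 6 * u 2),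
      u 0 * v 1 - u 1 * v 0 + (u 5 * v 3 - v 5 * u 3),
      u 0 * v 2 - u 2 * v 0 + (u 5 * v 4 - v 5 * u 4) * lam + (u 6 * v 2 - v 6 * u 2)
        + (u 6 * v 4 - v 6 * u 4),
      0, 0] := by
  funext k
  fin_cases k <;>
    simp [solvBracket, solvBracketCoord, nilBracket, matX, matY, Fin.sum_univ_five,
      Matrix.diagonal, Matrix.single, Fin.castAdd, Fin.castLE] <;> ring

theorem solvBracket_add_left (K : SolvKind) (u v w : Fin 7 → ℝ) :
    solvBracket K (u + v) w = solvBracket K u w + solvBracket K v w := by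
  funext k
  cases K <;>
    simp only [solvBracket_g2, solvBracket_g3, solvBracket_g4, solvBracket_g9, solvBracket_g10] <;>
    fin_cases k <;> simp <;> ring

theorem solvBracket_add_right (K : SolvKind) (u v w : Fin 7 → ℝ) :
    solvBracket K u (v + w) = solvBracket K u v + solvBracket K u w := by
  funext k
  cases K <;>
    simp only [solvBracket_g2, solvBracket_g3, solvBracket_g4, solvBracket_g9, solvBracket_g10] <;>
    fin_cases k <;> simp <;> ring

theorem solvBracket_self (K : SolvKind) (u : Fin 7 → ℝ) :
    solvBracket K u u = 0 := by
  funext k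
  cases K <;>
    simp only [solvBracket_g2, solvBracket_g3, solvBracket_g4, solvBracket_g9, solvBracket_g10] <;>
    fin_cases k <;> simp <;> ring

theorem solvBracket_leibniz (K : SolvKind) (u v w : Fin 7 → ℝ) :
    solvBracket K u (solvBracket K v w)
      = solvBracket K (solvBracket K u v) w + solvBracket K v (solvBracket K u w) := by
  funext k
  cases K <;>
    simp only [solvBracket_g2, solvBracket_g3, solvBracket_g4, solvBracket_g9, solvBracket_g10] <;>
    fin_cases k <;> simp <;> ring

theorem solvBracket_smul (K : SolvKind) (t : ℝ) (u v : Fin 7 → ℝ) :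
    solvBracket K u (t • v) = t • solvBracket K u v := by
  funext k
  cases K <;>
    simp only [solvBracket_g2, solvBracket_g3, solvBracket_g4, solvBracket_g9, solvBracket_g10] <;>
    fin_cases k <;> simp <;> ring

/-- The seven-dimensional real Lie algebra with label `K`. -/
instance instLieRingSolvLie (K : SolvKind) : LieRing (SolvLie K) where
  add_lie := solvBracket_add_left K
  lie_add := solvBracket_add_right K
  lie_self := solvBracket_self K
  leibniz_lie := solvBracket_leibniz K

instance instLieAlgebraSolvLie (K : SolvKind) : LieAlgebra ℝ (SolvLie K) where
  lie_smul := solvBracket_smul K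

/-- The fixed basis vectors; the indices `0, …, 6` stand for `X₁, …, X₅, X, Y`. -/
def SolvLie.vec (K : SolvKind) (i : Fin 7) : SolvLie K := (Pi.single i 1 : Fin 7 → ℝ)

/-- The model space `ℝ⁷` of seven-dimensional manifolds. -/
abbrev R7 : Type := EuclideanSpace ℝ (Fin 7)

/-- A smooth Lie group has the regularity under which Mathlib defines its Lie algebra. -/
instance instLieGroupMinSmoothness {G : Type*} [TopologicalSpace G] [ChartedSpace R7 G] [Group G]
    [LieGroup 𝓘(ℝ, R7) ∞ G] : LieGroup 𝓘(ℝ, R7) (minSmoothness ℝ 3) G :=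
  LieGroup.of_le (n := ∞) (by simp only [minSmoothness_of_isRCLikeNormedField]; exact ENat.LEInfty.out)

section Coadjoint

variable {G : Type*} [TopologicalSpace G] [ChartedSpace R7 G] [Group G]

/-- The adjoint action `Ad g`: the differential at the identity of `x ↦ g x g⁻¹`. -/
def lieAd (g : G) : GroupLieAlgebra 𝓘(ℝ, R7) G →L[ℝ] GroupLieAlgebra 𝓘(ℝ, R7) G :=
  mfderiv 𝓘(ℝ, R7) 𝓘(ℝ, R7) (fun x : G => g * x * g⁻¹) 1

/-- The coadjoint action: `⟨K(g) F, U⟩ = ⟨F, Ad(g⁻¹) U⟩`. -/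
def coadjoint (g : G) (F : Module.Dual ℝ (GroupLieAlgebra 𝓘(ℝ, R7) G)) :
    Module.Dual ℝ (GroupLieAlgebra 𝓘(ℝ, R7) G) :=
  F.comp (lieAd g⁻¹).toLinearMap

/-- The coadjoint orbit of `F`. -/
def coadjointOrbit (F : Module.Dual ℝ (GroupLieAlgebra 𝓘(ℝ, R7) G)) :
    Set (Module.Dual ℝ (GroupLieAlgebra 𝓘(ℝ, R7) G)) :=
  Set.range fun g : G => coadjoint g F

variable [LieGroup 𝓘(ℝ, R7) ∞ G] {K : SolvKind}

/-- The coordinates `(α₁, …, α₅, α, β)` of a linear form with respect to the dual of the basis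
`(X₁, …, X₅, X, Y)`, the Lie algebra of `G` being identified with `SolvLie K` by `e`. -/
def dualCoords (e : SolvLie K ≃ₗ⁅ℝ⁆ GroupLieAlgebra 𝓘(ℝ, R7) G)
    (F : Module.Dual ℝ (GroupLieAlgebra 𝓘(ℝ, R7) G)) : Fin 7 → ℝ :=
  fun i => F (e (SolvLie.vec K i))

/-- The dimension of the coadjoint orbit of `F`: the dimension of its tangent space at `F`, that
is, of the image of the differential at the identity of the orbit map `g ↦ K(g) F`, which is read
in the linear coordinates `dualCoords e`. -/
def orbitDim (e : SolvLie K ≃ₗ⁅ℝ⁆ GroupLieAlgebra 𝓘(ℝ, R7) G)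
    (F : Module.Dual ℝ (GroupLieAlgebra 𝓘(ℝ, R7) G)) : ℕ :=
  Module.finrank ℝ (LinearMap.range
    (mfderiv 𝓘(ℝ, R7) 𝓘(ℝ, Fin 7 → ℝ)
      (fun g : G => dualCoords e (coadjoint g F)) 1).toLinearMap)

end Coadjoint

/-- `S` is part of an (irreducible) algebraic hypersurface of degree two in `ℝ⁷`. -/
def IsPartOfQuadric (S : Set (Fin 7 → ℝ)) : Prop :=
  ∃ p : MvPolynomial (Fin 7) ℝ, Irreducible p ∧ p.totalDegree = 2 ∧
    ∀ x ∈ S, MvPolynomial.eval x p = 0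

/-- `S` is not part of any algebraic hypersurface of `ℝ⁷`: no nonzero polynomial vanishes on it. -/
def IsTranscendentalSet (S : Set (Fin 7 → ℝ)) : Prop :=
  ∀ p : MvPolynomial (Fin 7) ℝ, (∀ x ∈ S, MvPolynomial.eval x p = 0) → p = 0

end

/-! No explicit group law is needed: everything follows from the infinitesimal coadjoint action
`coadMap`, which sends `u` to `⟨F, [u, ·]⟩` in coordinates, together with connectedness of the
group.

Dimension. The orbit map has differential `-F ∘ ad` at the identity, so the orbit dimension is the
rank of `coadMap` (`orbitDim_eq`). Its matrix is skew-symmetric of odd size 7, hence singular, and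
the rank is at most 6. Where six of the seven coordinates of `coadMap` can be prescribed freely, the
rank is 6. Where two coordinates vanish identically, skew-symmetry puts two basis vectors in the
kernel and the rank is below 6. These two alternatives exhaust all `F` in each family.

Orbits. Let `S` be the proposed set. Along a path in the group, `F ∘ Ad` solves `x' = coadMap x u`
for some continuous `u`. A set stable under all these equations is therefore stable under a
neighbourhood of the identity, and hence under the connected group
(`coadjointOrbit_subset_of_isFlowInvariant`). Stability of `S` is elementary. Certain coordinates
satisfy `c' = a c`, so they stay zero or keep their sign, and when `α₄α₅ ≠ 0` the displayed function
of the coordinates is a first integral. Conversely, `S` is a graph over an intersection of two open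
half-spaces of `ℝ⁶`. The orbits in `S` project to disjoint open subsets of this convex set by the
submersion theorem, so there is only one (`coadjointOrbit_eq_preimage`).

Hypersurfaces. Clearing denominators gives a quadric that is linear in one variable with prime
coefficient, hence irreducible. The logarithmic orbits contain enough curves built from `s` and `exp
s`, and the algebraic independence of these two functions kills every vanishing polynomial. -/

/-! ### Calculus of a local multiplication on a normed space -/

section LocalGroup

open Filter Topology ContinuousLinearMap

variable {E : Type*} [NormedAddCommGroup E] [NormedSpace ℝ E]

/-- The frame of left-invariant fields of a local multiplication `m` with unit `p`. -/
noncomputable def leftFrame (m : E × E → E) (p x : E) : E →L[ℝ] E :=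
  (fderiv ℝ m (x, p)).comp (inr ℝ E E)

/-- The frame of right-invariant fields of a local multiplication `m` with unit `p`. -/
noncomputable def rightFrame (m : E × E → E) (p x : E) : E →L[ℝ] E :=
  (fderiv ℝ m (p, x)).comp (inl ℝ E E)

/-- The commutator of left-invariant fields of a local multiplication at its unit. -/
noncomputable def frameBracket (m : E × E → E) (p : E) : E →L[ℝ] E →L[ℝ] E :=
  fderiv ℝ (leftFrame m p) p - (fderiv ℝ (leftFrame m p) p).flip

theorem hasFDerivAt_mk_left {m : E × E → E} {x y : E} (hm : DifferentiableAt ℝ m (x, y)) :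
    HasFDerivAt (fun z => m (x, z)) ((fderiv ℝ m (x, y)).comp (inr ℝ E E)) y :=
  HasFDerivAt.comp y hm.hasFDerivAt (hasFDerivAt_prodMk_right x y)

theorem hasFDerivAt_mk_right {m : E × E → E} {x y : E} (hm : DifferentiableAt ℝ m (x, y)) :
    HasFDerivAt (fun z => m (z, y)) ((fderiv ℝ m (x, y)).comp (inl ℝ E E)) x :=
  HasFDerivAt.comp x hm.hasFDerivAt (hasFDerivAt_prodMk_left x y)

variable {m : E × E → E} {p : E}

theorem contDiffAt_leftFrame (hm : ContDiffAt ℝ 3 m (p, p)) :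
    ContDiffAt ℝ 2 (leftFrame m p) p := by
  have h : ContDiffAt ℝ 2 (fderiv ℝ m) (p, p) := hm.fderiv_right (by norm_num)
  have h2 : ContDiffAt ℝ 2 (fun x : E => fderiv ℝ m (x, p)) p :=
    ContDiffAt.comp (g := fderiv ℝ m) (f := fun x : E => (x, p)) p h
      (contDiffAt_id.prodMk contDiffAt_const)
  exact h2.clm_comp contDiffAt_const

theorem contDiffAt_rightFrame (hm : ContDiffAt ℝ 3 m (p, p)) :
    ContDiffAt ℝ 2 (rightFrame m p) p := by
  have h : ContDiffAt ℝ 2 (fderiv ℝ m) (p, p) := hm.fderiv_right (by norm_num)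
  have h2 : ContDiffAt ℝ 2 (fun x : E => fderiv ℝ m (p, x)) p :=
    ContDiffAt.comp (g := fderiv ℝ m) (f := fun x : E => (p, x)) p h
      (contDiffAt_const.prodMk contDiffAt_id)
  exact h2.clm_comp contDiffAt_const

theorem leftFrame_self (hm : ContDiffAt ℝ 3 m (p, p)) (hr : ∀ᶠ x in 𝓝 p, m (p, x) = x) :
    leftFrame m p p = .id ℝ E :=
  ((hasFDerivAt_mk_left (hm.differentiableAt (by norm_num))).congr_of_eventuallyEq
    (hr.mono fun _ h => h.symm)).unique (hasFDerivAt_id p)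

theorem rightFrame_self (hm : ContDiffAt ℝ 3 m (p, p)) (hl : ∀ᶠ x in 𝓝 p, m (x, p) = x) :
    rightFrame m p p = .id ℝ E :=
  ((hasFDerivAt_mk_right (hm.differentiableAt (by norm_num))).congr_of_eventuallyEq
    (hl.mono fun _ h => h.symm)).unique (hasFDerivAt_id p)

/-- Both sides are mixed second derivatives of `m` at `(p, p)`, taken in opposite orders, so this is
the symmetry of the second derivative. -/
theorem fderiv_rightFrame_eq_flip (hm : ContDiffAt ℝ 3 m (p, p)) :
    fderiv ℝ (rightFrame m p) p = (fderiv ℝ (leftFrame m p) p).flip := by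
  have h : DifferentiableAt ℝ (fderiv ℝ m) (p, p) :=
    (hm.fderiv_right (m := 2) (by norm_num)).differentiableAt (by norm_num)
  have hL0 : HasFDerivAt (fun x : E => fderiv ℝ m (x, p))
      ((fderiv ℝ (fderiv ℝ m) (p, p)).comp (inl ℝ E E)) p :=
    HasFDerivAt.comp p h.hasFDerivAt (hasFDerivAt_prodMk_left p p)
  have hR0 : HasFDerivAt (fun x : E => fderiv ℝ m (p, x))
      ((fderiv ℝ (fderiv ℝ m) (p, p)).comp (inr ℝ E E)) p :=
    HasFDerivAt.comp p h.hasFDerivAt (hasFDerivAt_prodMk_right p p)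
  have hL : HasFDerivAt (leftFrame m p) _ p :=
    hL0.clm_comp (hasFDerivAt_const (inr ℝ E E) p)
  have hR : HasFDerivAt (rightFrame m p) _ p :=
    hR0.clm_comp (hasFDerivAt_const (inl ℝ E E) p)
  have hs : IsSymmSndFDerivAt ℝ m (p, p) := hm.isSymmSndFDerivAt (by simp; norm_num)
  rw [hL.fderiv, hR.fderiv]
  ext v w
  simpa using hs.eq (0, v) (w, 0)

theorem lieBracket_leftFrame (hm : ContDiffAt ℝ 3 m (p, p)) (hr : ∀ᶠ x in 𝓝 p, m (p, x) = x)
    (v w : E) : VectorField.lieBracket ℝ (fun x => leftFrame m p x v) (fun x => leftFrame m p x w) p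
      = frameBracket m p v w := by
  have hL : HasFDerivAt (leftFrame m p) _ p :=
    ((contDiffAt_leftFrame hm).differentiableAt (by norm_num)).hasFDerivAt
  have hu : ∀ u : E, HasFDerivAt (fun x => leftFrame m p x u)
      ((fderiv ℝ (leftFrame m p) p).flip u) p := by
    intro u
    simpa using hL.clm_apply (hasFDerivAt_const u p)
  rw [VectorField.lieBracket, (hu v).fderiv, (hu w).fderiv, leftFrame_self hm hr]
  simp [frameBracket]

variable {A : E → E →L[ℝ] E}

theorem hasFDerivAt_inverse_of_eq_one [CompleteSpace E] {A' : E →L[ℝ] E →L[ℝ] E}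
    (hA : HasFDerivAt A A' p) (hp : A p = 1) :
    HasFDerivAt (fun x => Ring.inverse (A x)) (-A') p := by
  have h1 : HasFDerivAt Ring.inverse
      (-ContinuousLinearMap.mulLeftRight ℝ (E →L[ℝ] E) 1 1) (A p) := by
    rw [hp]
    simpa using hasFDerivAt_ringInverse (𝕜 := ℝ) (1 : (E →L[ℝ] E)ˣ)
  have h2 : (-ContinuousLinearMap.mulLeftRight ℝ (E →L[ℝ] E) 1 1).comp A' = -A' := by
    ext v w
    simp
  rw [← h2]
  exact HasFDerivAt.comp p h1 hA

theorem eventually_isInvertible [CompleteSpace E] {V : E → E →L[ℝ] E}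
    (hV : ContinuousAt V p) (hp : V p = .id ℝ E) : ∀ᶠ x in 𝓝 p, (V x).IsInvertible := by
  have : {T : E →L[ℝ] E | T.IsInvertible} ∈ 𝓝 (V p) := by
    rw [hp]
    exact ContinuousLinearEquiv.nhds (ContinuousLinearEquiv.refl ℝ E)
  exact hV this

theorem contDiffAt_inverse_of_eq_id [CompleteSpace E] {V : E → E →L[ℝ] E} {n : WithTop ℕ∞}
    (hV : ContDiffAt ℝ n V p) (hp : V p = .id ℝ E) :
    ContDiffAt ℝ n (fun x => (V x).inverse) p := by
  refine ContDiffAt.comp p (g := ContinuousLinearMap.inverse) ?_ hV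
  rw [hp]
  exact contDiffAt_map_inverse (ContinuousLinearEquiv.refl ℝ E)

/-- No regularity of `A` is assumed. The right frame is the identity at `p`, hence invertible
nearby, and `A` is the inverse of the right frame composed with the left one. -/
theorem contDiffAt_adjoint [CompleteSpace E] (hm : ContDiffAt ℝ 3 m (p, p))
    (hl : ∀ᶠ x in 𝓝 p, m (x, p) = x)
    (hA : ∀ᶠ x in 𝓝 p, (rightFrame m p x).comp (A x) = leftFrame m p x) :
    ContDiffAt ℝ 2 A p := by
  have hR := contDiffAt_rightFrame hm
  have hinv := contDiffAt_inverse_of_eq_id hR (rightFrame_self hm hl)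
  refine (hinv.clm_comp (contDiffAt_leftFrame hm)).congr_of_eventuallyEq ?_
  filter_upwards [hA, eventually_isInvertible hR.continuousAt (rightFrame_self hm hl)] with x h1 h2
  rw [← h1, ← ContinuousLinearMap.comp_assoc, h2.inverse_comp_self, ContinuousLinearMap.id_comp]

/-- This is `d(Ad) = ad`. Differentiating `R(x) A(x) = L(x)` at `p`, where all three factors are the
identity, gives `A' = L' - R'`, and `R'` is the flip of `L'`. -/
theorem hasFDerivAt_adjoint [CompleteSpace E] (hm : ContDiffAt ℝ 3 m (p, p))
    (hl : ∀ᶠ x in 𝓝 p, m (x, p) = x) (hr : ∀ᶠ x in 𝓝 p, m (p, x) = x)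
    (hA : ∀ᶠ x in 𝓝 p, (rightFrame m p x).comp (A x) = leftFrame m p x) :
    A p = .id ℝ E ∧ HasFDerivAt A (frameBracket m p) p := by
  have hAp : A p = .id ℝ E := by
    have := hA.self_of_nhds
    rwa [leftFrame_self hm hr, rightFrame_self hm hl, ContinuousLinearMap.id_comp] at this
  refine ⟨hAp, ?_⟩
  have hd : DifferentiableAt ℝ A p :=
    (contDiffAt_adjoint hm hl hA).differentiableAt (by norm_num)
  have hL : HasFDerivAt (leftFrame m p) _ p :=
    ((contDiffAt_leftFrame hm).differentiableAt (by norm_num)).hasFDerivAt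
  have hR : HasFDerivAt (rightFrame m p) _ p :=
    ((contDiffAt_rightFrame hm).differentiableAt (by norm_num)).hasFDerivAt
  have h1 := ((hR.clm_comp hd.hasFDerivAt).congr_of_eventuallyEq
    (hA.mono fun _ h => h.symm)).unique hL
  convert hd.hasFDerivAt using 1
  ext v w
  have h2 := congrArg (fun T : E →L[ℝ] E →L[ℝ] E => T v w) h1
  rw [fderiv_rightFrame_eq_flip hm, rightFrame_self hm hl, hAp] at h2
  simp at h2
  simp [frameBracket, ← h2]

/-- Differentiating `A (m (x, z)) = A x ∘ A z` in `z` at the unit gives `A'(x) ∘ L(x) = A(x) ∘ ad`,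
and the left frame is invertible near `p`. This is the differential equation obeyed by `Ad` along
paths. -/
theorem eventually_hasFDerivAt_adjoint [CompleteSpace E] (hm : ContDiffAt ℝ 3 m (p, p))
    (hl : ∀ᶠ x in 𝓝 p, m (x, p) = x) (hr : ∀ᶠ x in 𝓝 p, m (p, x) = x)
    (hA : ∀ᶠ x in 𝓝 p, (rightFrame m p x).comp (A x) = leftFrame m p x)
    (hmul : ∀ᶠ q in 𝓝 (p, p), A (m q) = (A q.1).comp (A q.2)) :
    ∀ᶠ x in 𝓝 p, HasFDerivAt A
      ((compL ℝ E E E (A x)).comp ((frameBracket m p).comp (leftFrame m p x).inverse)) x := by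
  obtain ⟨hAp, hA'⟩ := hasFDerivAt_adjoint hm hl hr hA
  have hd : ∀ᶠ x in 𝓝 p, DifferentiableAt ℝ A x := by
    filter_upwards [(contDiffAt_adjoint hm hl hA).eventually (by simp)] with x h
    exact h.differentiableAt (by norm_num)
  have hdm : ∀ᶠ x in 𝓝 p, DifferentiableAt ℝ m (x, p) := by
    have h1 := hm.eventually (by simp)
    have h2 : Tendsto (fun x : E => (x, p)) (𝓝 p) (𝓝 (p, p)) :=
      (continuous_id.prodMk continuous_const).tendsto p
    filter_upwards [h2.eventually h1] with x h
    exact h.differentiableAt (by norm_num)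
  have hL := contDiffAt_leftFrame hm
  rw [nhds_prod_eq] at hmul
  have hmul' : ∀ᶠ x in 𝓝 p, ∀ᶠ z in 𝓝 p, A (m (x, z)) = (A x).comp (A z) := hmul.curry
  filter_upwards [hd, hdm, hl, hmul',
    eventually_isInvertible hL.continuousAt (leftFrame_self hm hr)] with x h1 h2 h3 h4 h5
  have e1 : HasFDerivAt (fun z => A (m (x, z))) ((fderiv ℝ A x).comp (leftFrame m p x)) p := by
    refine HasFDerivAt.comp p ?_ (hasFDerivAt_mk_left h2)
    simpa [h3] using h1.hasFDerivAt
  have e2 : HasFDerivAt (fun z => (A x).comp (A z))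
      ((compL ℝ E E E (A x)).comp (frameBracket m p)) p :=
    HasFDerivAt.comp p (g := fun T => (A x).comp T) (compL ℝ E E E (A x)).hasFDerivAt hA'
  have e3 := e1.unique (e2.congr_of_eventuallyEq h4)
  convert h1.hasFDerivAt using 1
  rw [← ContinuousLinearMap.comp_assoc, ← e3, ContinuousLinearMap.comp_assoc, h5.self_comp_inverse,
    ContinuousLinearMap.comp_id]

end LocalGroup

/-! ### The group multiplication read in a chart at the identity -/

section GroupChart

open Filter Topology Set

variable {G : Type*} [TopologicalSpace G] [ChartedSpace R7 G] [Group G]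

variable (G) in
/-- The coordinates of the identity in the preferred chart around it. -/
noncomputable def unitCoord : R7 := extChartAt 𝓘(ℝ, R7) (1 : G) 1

variable (G) in
/-- The group element with given coordinates in the preferred chart around the identity. -/
noncomputable def ofCoord : R7 → G := (extChartAt 𝓘(ℝ, R7) (1 : G)).symm

variable (G) in
/-- The multiplication read in the preferred chart around the identity. -/
noncomputable def chartMul (q : R7 × R7) : R7 :=
  extChartAt 𝓘(ℝ, R7) (1 : G) (ofCoord G q.1 * ofCoord G q.2)

theorem ofCoord_unitCoord : ofCoord G (unitCoord G) = 1 :=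
  extChartAt_to_inv 1

theorem target_mem_nhds_unitCoord :
    (extChartAt 𝓘(ℝ, R7) (1 : G)).target ∈ 𝓝 (unitCoord G) :=
  extChartAt_target_mem_nhds 1

theorem source_mem_nhds_one : (extChartAt 𝓘(ℝ, R7) (1 : G)).source ∈ 𝓝 (1 : G) :=
  extChartAt_source_mem_nhds 1

theorem continuousAt_ofCoord : ContinuousAt (ofCoord G) (unitCoord G) :=
  continuousAt_extChartAt_symm 1

/-- The model has no boundary, so the chart covers a full neighbourhood of the identity and local
statements in coordinates transfer to the group. -/
theorem map_ofCoord_nhds : map (ofCoord G) (𝓝 (unitCoord G)) = 𝓝 1 := by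
  have h := map_extChartAt_symm_nhdsWithin_range (I := 𝓘(ℝ, R7)) (1 : G)
  rw [modelWithCornersSelf_coe, range_id, nhdsWithin_univ] at h
  exact h

theorem ofCoord_chartMul {x y : R7}
    (h : ofCoord G x * ofCoord G y ∈ (extChartAt 𝓘(ℝ, R7) (1 : G)).source) :
    ofCoord G (chartMul G (x, y)) = ofCoord G x * ofCoord G y :=
  (extChartAt 𝓘(ℝ, R7) (1 : G)).left_inv h

theorem chartMul_unit_right {x : R7} (h : x ∈ (extChartAt 𝓘(ℝ, R7) (1 : G)).target) :
    chartMul G (x, unitCoord G) = x := by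
  simp only [chartMul, ofCoord_unitCoord, mul_one]
  exact (extChartAt 𝓘(ℝ, R7) (1 : G)).right_inv h

theorem chartMul_unit_left {x : R7} (h : x ∈ (extChartAt 𝓘(ℝ, R7) (1 : G)).target) :
    chartMul G (unitCoord G, x) = x := by
  simp only [chartMul, ofCoord_unitCoord, one_mul]
  exact (extChartAt 𝓘(ℝ, R7) (1 : G)).right_inv h

/-- The differential at the identity of a map fixing the identity, read in the chart. -/
theorem mfderiv_one_eq_fderiv {f : G → G} (hf : MDifferentiableAt 𝓘(ℝ, R7) 𝓘(ℝ, R7) f 1)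
    (h1 : f 1 = 1) :
    (mfderiv 𝓘(ℝ, R7) 𝓘(ℝ, R7) f 1 : R7 →L[ℝ] R7) =
      fderiv ℝ (fun x => extChartAt 𝓘(ℝ, R7) (1 : G) (f (ofCoord G x))) (unitCoord G) := by
  rw [hf.mfderiv]
  simp only [writtenInExtChartAt, h1]
  simp only [modelWithCornersSelf_coe, range_id, fderivWithin_univ]
  rfl

variable [LieGroup 𝓘(ℝ, R7) ∞ G]

theorem contMDiffAt_ofCoord {x : R7} (hx : x ∈ (extChartAt 𝓘(ℝ, R7) (1 : G)).target) :
    ContMDiffAt 𝓘(ℝ, R7) 𝓘(ℝ, R7) ∞ (ofCoord G) x :=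
  (contMDiffOn_extChartAt_symm 1 x hx).contMDiffAt ((isOpen_extChartAt_target 1).mem_nhds hx)

theorem contMDiffAt_chart {g : G} (hg : g ∈ (extChartAt 𝓘(ℝ, R7) (1 : G)).source) :
    ContMDiffAt 𝓘(ℝ, R7) 𝓘(ℝ, R7) ∞ (extChartAt 𝓘(ℝ, R7) (1 : G)) g :=
  contMDiffAt_extChartAt' (by simpa using hg)

theorem eventually_mul_mem_source : ∀ᶠ q in 𝓝 (unitCoord G, unitCoord G),
    ofCoord G q.1 * ofCoord G q.2 ∈ (extChartAt 𝓘(ℝ, R7) (1 : G)).source := by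
  have : IsTopologicalGroup G := topologicalGroup_of_lieGroup 𝓘(ℝ, R7) ∞
  have h1 : ContinuousAt (fun q : R7 × R7 => ofCoord G q.1 * ofCoord G q.2)
      (unitCoord G, unitCoord G) :=
    (ContinuousAt.comp (f := Prod.fst) (x := (unitCoord G, unitCoord G)) continuousAt_ofCoord
      continuousAt_fst).mul
      (ContinuousAt.comp (f := Prod.snd) (x := (unitCoord G, unitCoord G))
        continuousAt_ofCoord continuousAt_snd)
  refine h1 ?_
  simpa [ofCoord_unitCoord] using source_mem_nhds_one

theorem contDiffAt_chartMul {x y : R7}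
    (hx : x ∈ (extChartAt 𝓘(ℝ, R7) (1 : G)).target) (hy : y ∈ (extChartAt 𝓘(ℝ, R7) (1 : G)).target)
    (h : ofCoord G x * ofCoord G y ∈ (extChartAt 𝓘(ℝ, R7) (1 : G)).source) :
    ContDiffAt ℝ ∞ (chartMul G) (x, y) := by
  rw [← contMDiffAt_iff_contDiffAt]
  have h1 : ContMDiffAt 𝓘(ℝ, R7 × R7) 𝓘(ℝ, R7) ∞
      (fun q : R7 × R7 => ofCoord G q.1 * ofCoord G q.2) (x, y) :=
    (ContMDiffAt.comp (x, y) (contMDiffAt_ofCoord hx) contDiffAt_fst.contMDiffAt).mul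
      (ContMDiffAt.comp (x, y) (contMDiffAt_ofCoord hy) contDiffAt_snd.contMDiffAt)
  exact ContMDiffAt.comp (x, y) (contMDiffAt_chart h) h1

theorem contDiffAt_chartMul_unit : ContDiffAt ℝ 3 (chartMul G) (unitCoord G, unitCoord G) := by
  refine (contDiffAt_chartMul ?_ ?_ ?_).of_le ENat.LEInfty.out
  · exact mem_of_mem_nhds target_mem_nhds_unitCoord
  · exact mem_of_mem_nhds target_mem_nhds_unitCoord
  · exact eventually_mul_mem_source.self_of_nhds

theorem lieAd_eq_fderiv (g : G) : (lieAd g : R7 →L[ℝ] R7) =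
      fderiv ℝ (fun x => extChartAt 𝓘(ℝ, R7) (1 : G) (g * ofCoord G x * g⁻¹)) (unitCoord G) := by
  refine mfderiv_one_eq_fderiv ?_ (by simp)
  have : ContMDiff 𝓘(ℝ, R7) 𝓘(ℝ, R7) ∞ (fun x : G => g * x * g⁻¹) :=
    (contMDiff_const.mul contMDiff_id).mul contMDiff_const
  exact this.mdifferentiableAt (by simp)

end GroupChart

/-! ### The adjoint action and the Lie bracket in the chart -/

section GroupChart

open Filter Topology Set VectorField

variable {G : Type*} [TopologicalSpace G] [ChartedSpace R7 G] [Group G]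
  [LieGroup 𝓘(ℝ, R7) ∞ G]

/-- The adjoint action in the coordinates of the tangent space at the identity. -/
noncomputable def coordAd (g : G) : R7 →L[ℝ] R7 := lieAd g

/-- Conjugation by `g` read in the preferred chart around the identity. -/
noncomputable def chartConj (g : G) (x : R7) : R7 :=
  extChartAt 𝓘(ℝ, R7) (1 : G) (g * ofCoord G x * g⁻¹)

omit [LieGroup 𝓘(ℝ, R7) ∞ G] in
theorem chartConj_unitCoord (g : G) : chartConj g (unitCoord G) = unitCoord G := by
  simp only [chartConj, ofCoord_unitCoord, mul_one, mul_inv_cancel]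
  rfl

theorem contMDiffAt_conj_ofCoord (g : G) :
    ContMDiffAt 𝓘(ℝ, R7) 𝓘(ℝ, R7) ∞ (fun x => g * ofCoord G x * g⁻¹) (unitCoord G) :=
  (contMDiffAt_const.mul (contMDiffAt_ofCoord (mem_of_mem_nhds target_mem_nhds_unitCoord))).mul
    contMDiffAt_const

theorem hasFDerivAt_chartConj (g : G) :
    HasFDerivAt (chartConj g) (coordAd g) (unitCoord G) := by
  have h : ContMDiffAt 𝓘(ℝ, R7) 𝓘(ℝ, R7) ∞ (chartConj g) (unitCoord G) := by
    refine ContMDiffAt.comp _ (contMDiffAt_chart ?_) (contMDiffAt_conj_ofCoord g)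
    simp [ofCoord_unitCoord]
  rw [coordAd, lieAd_eq_fderiv]
  exact (h.contDiffAt.differentiableAt (by simp)).hasFDerivAt

theorem eventually_conj_mem_source (g : G) : ∀ᶠ x in 𝓝 (unitCoord G),
    g * ofCoord G x * g⁻¹ ∈ (extChartAt 𝓘(ℝ, R7) (1 : G)).source := by
  refine (contMDiffAt_conj_ofCoord g).continuousAt ?_
  simpa [ofCoord_unitCoord] using source_mem_nhds_one

theorem ofCoord_chartConj (g : G) : ∀ᶠ x in 𝓝 (unitCoord G),
    ofCoord G (chartConj g x) = g * ofCoord G x * g⁻¹ := by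
  filter_upwards [eventually_conj_mem_source g] with x hx
  exact (extChartAt 𝓘(ℝ, R7) (1 : G)).left_inv hx

theorem coordAd_mul (g h : G) :
    coordAd (g * h) = (coordAd g).comp (coordAd h) := by
  have h1 : HasFDerivAt (fun x => chartConj g (chartConj h x))
      ((coordAd g).comp (coordAd h)) (unitCoord G) := by
    refine HasFDerivAt.comp (unitCoord G) (g := chartConj g) ?_ (hasFDerivAt_chartConj h)
    rw [chartConj_unitCoord]
    exact hasFDerivAt_chartConj g
  refine (hasFDerivAt_chartConj (g * h)).unique (h1.congr_of_eventuallyEq ?_)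
  filter_upwards [ofCoord_chartConj h] with x hx
  simp only [chartConj] at hx ⊢
  rw [hx, mul_inv_rev]
  simp only [mul_assoc]

theorem coordAd_one : coordAd (1 : G) = .id ℝ R7 := by
  refine (hasFDerivAt_chartConj (1 : G)).unique ((hasFDerivAt_id _).congr_of_eventuallyEq ?_)
  filter_upwards [target_mem_nhds_unitCoord (G := G)] with x hx
  simp only [chartConj, one_mul, inv_one, mul_one]
  exact (extChartAt 𝓘(ℝ, R7) (1 : G)).right_inv hx

omit [LieGroup 𝓘(ℝ, R7) ∞ G] in
theorem eventually_ofCoord_mem_source : ∀ᶠ x in 𝓝 (unitCoord G),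
    ofCoord G x ∈ (extChartAt 𝓘(ℝ, R7) (1 : G)).source := by
  filter_upwards [target_mem_nhds_unitCoord (G := G)] with x hx
  exact (extChartAt 𝓘(ℝ, R7) (1 : G)).map_target hx

/-- This is the derivative in `y` at the identity of `(x y x⁻¹) x = x y`. It supplies the hypothesis
on `A` in the local calculus. -/
theorem rightFrame_comp_coordAd : ∀ᶠ x in 𝓝 (unitCoord G),
    (rightFrame (chartMul G) (unitCoord G) x).comp (coordAd (ofCoord G x)) =
      leftFrame (chartMul G) (unitCoord G) x := by
  have hp := mem_of_mem_nhds (target_mem_nhds_unitCoord (G := G))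
  filter_upwards [target_mem_nhds_unitCoord (G := G), eventually_ofCoord_mem_source] with x hx hxs
  have d1 : DifferentiableAt ℝ (chartMul G) (x, unitCoord G) :=
    (contDiffAt_chartMul hx hp (by simpa [ofCoord_unitCoord] using hxs)).differentiableAt (by simp)
  have d2 : DifferentiableAt ℝ (chartMul G) (unitCoord G, x) :=
    (contDiffAt_chartMul hp hx (by simpa [ofCoord_unitCoord] using hxs)).differentiableAt (by simp)
  have h1 := hasFDerivAt_mk_left d1
  have h2 : HasFDerivAt (fun y => chartMul G (chartConj (ofCoord G x) y, x))
      ((rightFrame (chartMul G) (unitCoord G) x).comp (coordAd (ofCoord G x)))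
      (unitCoord G) := by
    refine HasFDerivAt.comp (unitCoord G) (g := fun z => chartMul G (z, x)) ?_
      (hasFDerivAt_chartConj (ofCoord G x))
    rw [chartConj_unitCoord]
    exact hasFDerivAt_mk_right d2
  refine (h2.congr_of_eventuallyEq ?_).unique h1
  filter_upwards [ofCoord_chartConj (ofCoord G x)] with y hy
  simp [chartMul, hy]

/-- The left-invariant fields, read in the chart. -/
theorem mpullbackWithin_mulInvariantVectorField {x : R7}
    (hx : x ∈ (extChartAt 𝓘(ℝ, R7) (1 : G)).target) (w : R7) :
    mpullbackWithin 𝓘(ℝ, R7) 𝓘(ℝ, R7) (extChartAt 𝓘(ℝ, R7) (1 : G)).symm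
      (mulInvariantVectorField (I := 𝓘(ℝ, R7)) (G := G) w) (range 𝓘(ℝ, R7)) x =
      leftFrame (chartMul G) (unitCoord G) x w := by
  have hp := mem_of_mem_nhds (target_mem_nhds_unitCoord (G := G))
  have hxs : ofCoord G x ∈ (extChartAt 𝓘(ℝ, R7) (1 : G)).source :=
    (extChartAt 𝓘(ℝ, R7) (1 : G)).map_target hx
  have e1 := mfderiv_extChartAt_comp_mfderivWithin_extChartAt_symm (I := 𝓘(ℝ, R7)) hx
  have e2 := mfderivWithin_extChartAt_symm_comp_mfderiv_extChartAt (I := 𝓘(ℝ, R7)) hx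
  rw [mpullbackWithin_apply, ContinuousLinearMap.inverse_eq e2 e1]
  have d1 : MDifferentiableAt 𝓘(ℝ, R7) 𝓘(ℝ, R7) (extChartAt 𝓘(ℝ, R7) (1 : G))
      (ofCoord G x * 1) := by
    rw [mul_one]
    exact (contMDiffAt_chart hxs).mdifferentiableAt (by simp)
  have d2 : MDifferentiableAt 𝓘(ℝ, R7) 𝓘(ℝ, R7) (fun y : G => ofCoord G x * y) 1 :=
    (contMDiff_mul_left (I := 𝓘(ℝ, R7)) (n := ∞)).contMDiffAt.mdifferentiableAt (by simp)
  have h := mfderiv_comp (1 : G) d1 d2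
  have h3 := (d1.comp (1 : G) d2).mfderiv
  rw [h] at h3
  have h4 : (fderivWithin ℝ (writtenInExtChartAt 𝓘(ℝ, R7) 𝓘(ℝ, R7) (1 : G)
      (extChartAt 𝓘(ℝ, R7) (1 : G) ∘ fun y : G => ofCoord G x * y)) (range 𝓘(ℝ, R7))
        (extChartAt 𝓘(ℝ, R7) (1 : G) 1) : R7 →L[ℝ] R7) =
      leftFrame (chartMul G) (unitCoord G) x := by
    rw [modelWithCornersSelf_coe, range_id, fderivWithin_univ]
    exact (hasFDerivAt_mk_left ((contDiffAt_chartMul hx hp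
      (by simpa [ofCoord_unitCoord] using hxs)).differentiableAt (by simp))).fderiv
  have h5 := congrArg (fun T : R7 →L[ℝ] R7 => T w) (h3.trans h4)
  refine Eq.trans ?_ h5
  -- The chain rule was applied at the base point `ofCoord G x * 1`; this moves the chart
  -- differential to `ofCoord G x`.
  have e3 : ∀ g : G, g = ofCoord G x →
      (mfderiv 𝓘(ℝ, R7) 𝓘(ℝ, R7) (extChartAt 𝓘(ℝ, R7) (1 : G)) (ofCoord G x) : R7 →L[ℝ] R7) =
      (mfderiv 𝓘(ℝ, R7) 𝓘(ℝ, R7) (extChartAt 𝓘(ℝ, R7) (1 : G)) g : R7 →L[ℝ] R7) := by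
    rintro _ rfl
    rfl
  exact congrArg (fun T : R7 →L[ℝ] R7 =>
    T (mfderiv 𝓘(ℝ, R7) 𝓘(ℝ, R7) (fun y : G => ofCoord G x * y) 1 w)) (e3 _ (mul_one _))

/-- The bracket of the group Lie algebra is the commutator at the identity of left-invariant fields.
In the chart these fields are the left frame, and the chart has identity differential at its centre.
-/
theorem frameBracket_chartMul (v w : GroupLieAlgebra 𝓘(ℝ, R7) G) :
    frameBracket (chartMul G) (unitCoord G) v w = ⁅v, w⁆ := by
  rw [GroupLieAlgebra.bracket_def, ← mlieBracketWithin_univ, mlieBracketWithin_apply,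
    mfderiv_extChartAt_self]
  have key : ∀ u : R7, mpullbackWithin 𝓘(ℝ, R7) 𝓘(ℝ, R7) (extChartAt 𝓘(ℝ, R7) (1 : G)).symm
      (mulInvariantVectorField (I := 𝓘(ℝ, R7)) (G := G) u) (range 𝓘(ℝ, R7)) =ᶠ[𝓝 (unitCoord G)]
      fun x => leftFrame (chartMul G) (unitCoord G) x u := by
    intro u
    filter_upwards [target_mem_nhds_unitCoord (G := G)] with x hx
    exact mpullbackWithin_mulInvariantVectorField hx u
  have h1 := Filter.EventuallyEq.lieBracket_vectorField_eq (𝕜 := ℝ) (key v) (key w)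
  have h2 := lieBracket_leftFrame (contDiffAt_chartMul_unit (G := G)) (by
      filter_upwards [target_mem_nhds_unitCoord (G := G)] with x hx
      exact chartMul_unit_left hx) v w
  have h3 : (extChartAt 𝓘(ℝ, R7) (1 : G)).symm ⁻¹' univ ∩ range 𝓘(ℝ, R7) = univ := by simp
  refine (h2.symm.trans h1.symm).trans ?_
  rw [h3]
  have h4 : (ContinuousLinearMap.id ℝ R7).inverse = ContinuousLinearMap.id ℝ R7 :=
    ContinuousLinearMap.inverse_id
  exact (congrFun lieBracketWithin_univ _).symm.trans
    (congrArg (fun T : R7 →L[ℝ] R7 => T _) h4.symm)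

end GroupChart

/-! ### The infinitesimal coadjoint action in coordinates -/

theorem solvBracket_smul_left (K : SolvKind) (t : ℝ) (u v : Fin 7 → ℝ) :
    solvBracket K (t • u) v = t • solvBracket K u v :=
  smul_lie (R := ℝ) (L := SolvLie K) (M := SolvLie K) t u v

/-- The infinitesimal coadjoint action in coordinates: the `i`-th coordinate of
`U ↦ ⟨x, [u, U]⟩`. It is linear in `u`. -/
noncomputable def coadMap (K : SolvKind) (x : Fin 7 → ℝ) : (Fin 7 → ℝ) →ₗ[ℝ] (Fin 7 → ℝ) where
  toFun u i := ∑ j, solvBracket K u (Pi.single i 1) j * x j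
  map_add' u v := by
    ext i
    simp [solvBracket_add_left, add_mul, Finset.sum_add_distrib]
  map_smul' t u := by
    ext i
    simp [solvBracket_smul_left, mul_assoc, Finset.mul_sum]

section Coordinates

open Filter Topology Set

variable {G : Type*} [TopologicalSpace G] [ChartedSpace R7 G] [Group G]
  [LieGroup 𝓘(ℝ, R7) ∞ G] {K : SolvKind} (e : SolvLie K ≃ₗ⁅ℝ⁆ GroupLieAlgebra 𝓘(ℝ, R7) G)

theorem apply_eq_sum_dualCoords (F : Module.Dual ℝ (GroupLieAlgebra 𝓘(ℝ, R7) G))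
    (y : SolvLie K) : F (e y) = ∑ j, (y : Fin 7 → ℝ) j * dualCoords e F j := by
  have h : y = ∑ j, (y : Fin 7 → ℝ) j • SolvLie.vec K j :=
    (pi_eq_sum_univ' (R := ℝ) (y : Fin 7 → ℝ))
  conv_lhs => rw [h]
  rw [map_sum, map_sum]
  refine Finset.sum_congr rfl fun j _ => ?_
  rw [map_smul, map_smul]
  rfl

theorem dualCoords_injective : Function.Injective (dualCoords e) := by
  intro F F' h
  ext v
  obtain ⟨y, rfl⟩ : ∃ y, e y = v := e.surjective v
  rw [apply_eq_sum_dualCoords, apply_eq_sum_dualCoords, h]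

theorem dualCoords_surjective : Function.Surjective (dualCoords e) := by
  intro a
  let φ : SolvLie K →ₗ[ℝ] ℝ := (Fintype.linearCombination ℝ a : (Fin 7 → ℝ) →ₗ[ℝ] ℝ)
  refine ⟨φ.comp (e.symm : GroupLieAlgebra 𝓘(ℝ, R7) G →ₗ[ℝ] SolvLie K), ?_⟩
  ext i
  have : φ (SolvLie.vec K i) = a i := by
    have h : Fintype.linearCombination ℝ a (Pi.single i (1 : ℝ)) = a i := by simp
    exact h
  simpa [dualCoords] using this

/-- The coordinates of `F ∘ T` for an endomorphism `T` of the Lie algebra. -/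
noncomputable def compCoords (F : Module.Dual ℝ (GroupLieAlgebra 𝓘(ℝ, R7) G)) :
    (R7 →L[ℝ] R7) →L[ℝ] (Fin 7 → ℝ) :=
  LinearMap.toContinuousLinearMap
    { toFun := fun T i => F (T (e (SolvLie.vec K i)))
      map_add' := fun _ _ => funext fun _ => map_add F _ _
      map_smul' := fun t _ => funext fun _ => map_smul F t _ }

theorem compCoords_coordAd (F : Module.Dual ℝ (GroupLieAlgebra 𝓘(ℝ, R7) G)) (g : G) :
    compCoords e F (coordAd g) = dualCoords e (coadjoint g⁻¹ F) := by
  simp only [coadjoint, inv_inv]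
  rfl

/-- The identification of the Lie algebra with `ℝ⁷` by the fixed basis. -/
noncomputable def lieCoords : R7 ≃ₗ[ℝ] (Fin 7 → ℝ) :=
  (e.symm.toLinearEquiv : GroupLieAlgebra 𝓘(ℝ, R7) G ≃ₗ[ℝ] SolvLie K)

/-- The bridge from the abstract group to the structure constants: `e` preserves brackets, so `F ∘
ad v` can be computed in the fixed basis. -/
theorem compCoords_frameBracket (F : Module.Dual ℝ (GroupLieAlgebra 𝓘(ℝ, R7) G)) (v : R7) :
    compCoords e F (frameBracket (chartMul G) (unitCoord G) v) =
      coadMap K (dualCoords e F) (lieCoords e v) := by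
  ext i
  have h : ∀ u : GroupLieAlgebra 𝓘(ℝ, R7) G,
      ⁅u, e (SolvLie.vec K i)⁆ = e ⁅e.symm u, SolvLie.vec K i⁆ := by
    intro u
    rw [LieEquiv.map_lie, LieEquiv.apply_symm_apply]
  exact (congrArg F ((frameBracket_chartMul v _).trans (h v))).trans
    (apply_eq_sum_dualCoords e F _)

/-- The adjoint action read in the preferred chart around the identity. -/
noncomputable def chartAd (G : Type*) [TopologicalSpace G] [ChartedSpace R7 G] [Group G]
    (x : R7) : R7 →L[ℝ] R7 := coordAd (ofCoord G x)

omit [LieGroup 𝓘(ℝ, R7) ∞ G] in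
theorem eventually_chartMul_unit_right :
    ∀ᶠ x in 𝓝 (unitCoord G), chartMul G (x, unitCoord G) = x := by
  filter_upwards [target_mem_nhds_unitCoord (G := G)] with x hx
  exact chartMul_unit_right hx

omit [LieGroup 𝓘(ℝ, R7) ∞ G] in
theorem eventually_chartMul_unit_left :
    ∀ᶠ x in 𝓝 (unitCoord G), chartMul G (unitCoord G, x) = x := by
  filter_upwards [target_mem_nhds_unitCoord (G := G)] with x hx
  exact chartMul_unit_left hx

theorem contDiffAt_chartAd : ContDiffAt ℝ 2 (chartAd G) (unitCoord G) :=
  contDiffAt_adjoint contDiffAt_chartMul_unit eventually_chartMul_unit_right rightFrame_comp_coordAd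

theorem chartAd_unitCoord : chartAd G (unitCoord G) = .id ℝ R7 := by
  rw [chartAd, ofCoord_unitCoord, coordAd_one]

theorem hasFDerivAt_chartAd :
    HasFDerivAt (chartAd G) (frameBracket (chartMul G) (unitCoord G)) (unitCoord G) :=
  (hasFDerivAt_adjoint contDiffAt_chartMul_unit eventually_chartMul_unit_right
    eventually_chartMul_unit_left rightFrame_comp_coordAd).2

theorem eventually_hasFDerivAt_chartAd : ∀ᶠ x in 𝓝 (unitCoord G), HasFDerivAt (chartAd G)
    ((ContinuousLinearMap.compL ℝ R7 R7 R7 (chartAd G x)).comp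
      ((frameBracket (chartMul G) (unitCoord G)).comp
        (leftFrame (chartMul G) (unitCoord G) x).inverse)) x := by
  refine eventually_hasFDerivAt_adjoint contDiffAt_chartMul_unit eventually_chartMul_unit_right
    eventually_chartMul_unit_left rightFrame_comp_coordAd ?_
  filter_upwards [eventually_mul_mem_source (G := G)] with q hq
  simp only [chartAd]
  rw [← coordAd_mul, ← ofCoord_chartMul hq]

/-- The orbit map is `F ∘ Ad(g)⁻¹`. Inversion of operators has differential `-id` at the identity,
so the orbit map has differential `-F ∘ ad`, and the sign does not affect the range. -/
theorem orbitDim_eq (F : Module.Dual ℝ (GroupLieAlgebra 𝓘(ℝ, R7) G)) :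
    orbitDim e F = Module.finrank ℝ (LinearMap.range (coadMap K (dualCoords e F))) := by
  have hB : ∀ g : G, coordAd g⁻¹ = Ring.inverse (coordAd g) := by
    intro g
    have h1 : coordAd g⁻¹ * coordAd g = 1 := by
      rw [ContinuousLinearMap.mul_def, ← coordAd_mul, inv_mul_cancel, coordAd_one]; rfl
    have h2 : coordAd g * coordAd g⁻¹ = 1 := by
      rw [ContinuousLinearMap.mul_def, ← coordAd_mul, mul_inv_cancel, coordAd_one]; rfl
    exact (Ring.inverse_unit ⟨coordAd g, coordAd g⁻¹, h2, h1⟩).symm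
  have hf : ∀ g : G, dualCoords e (coadjoint g F) = compCoords e F (Ring.inverse (coordAd g)) := by
    intro g
    rw [← hB, compCoords_coordAd, inv_inv]
  have hinv : HasFDerivAt (fun x => Ring.inverse (chartAd G x))
      (-(frameBracket (chartMul G) (unitCoord G))) (unitCoord G) :=
    hasFDerivAt_inverse_of_eq_one hasFDerivAt_chartAd chartAd_unitCoord
  have hD : HasFDerivAt (fun x => compCoords e F (Ring.inverse (chartAd G x)))
      ((compCoords e F).comp (-(frameBracket (chartMul G) (unitCoord G)))) (unitCoord G) :=
    HasFDerivAt.comp (unitCoord G) (compCoords e F).hasFDerivAt hinv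
  have hM : HasMFDerivAt 𝓘(ℝ, R7) 𝓘(ℝ, Fin 7 → ℝ)
      (fun g : G => dualCoords e (coadjoint g F)) 1
      ((compCoords e F).comp (-(frameBracket (chartMul G) (unitCoord G)))) := by
    constructor
    · have hc : ContinuousAt (fun x => dualCoords e (coadjoint (ofCoord G x) F)) (unitCoord G) := by
        simp only [hf]
        exact hD.continuousAt
      have h1 : ContinuousAt (fun g : G => dualCoords e (coadjoint (ofCoord G
          (extChartAt 𝓘(ℝ, R7) (1 : G) g)) F)) 1 :=
        ContinuousAt.comp (f := extChartAt 𝓘(ℝ, R7) (1 : G)) hc (continuousAt_extChartAt 1)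
      refine h1.congr ?_
      filter_upwards [source_mem_nhds_one (G := G)] with g hg
      rw [ofCoord, (extChartAt 𝓘(ℝ, R7) (1 : G)).left_inv hg]
    · refine HasFDerivAt.hasFDerivWithinAt ?_
      simp only [hf]
      exact hD
  rw [orbitDim, hM.mfderiv]
  refine congrArg (fun S : Submodule ℝ (Fin 7 → ℝ) => Module.finrank ℝ S) ?_
  ext y
  constructor
  · rintro ⟨v, rfl⟩
    refine ⟨-(lieCoords e v), ?_⟩
    exact (map_neg _ _).trans ((congrArg Neg.neg (compCoords_frameBracket e F v).symm).trans
      (map_neg (compCoords e F) _).symm)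
  · rintro ⟨u, rfl⟩
    have := compCoords_frameBracket e F ((lieCoords e).symm u)
    rw [LinearEquiv.apply_symm_apply] at this
    rw [← this]
    refine ⟨-((lieCoords e).symm u), ?_⟩
    have h2 : compCoords e F (-frameBracket (chartMul G) (unitCoord G) (-((lieCoords e).symm u)))
        = compCoords e F (frameBracket (chartMul G) (unitCoord G) ((lieCoords e).symm u)) := by
      rw [map_neg (frameBracket (chartMul G) (unitCoord G)), neg_neg]
    exact h2

end Coordinates

/-! ### Orbits as flow-invariant sets -/

section Orbits

open Filter Topology Set

variable {G : Type*} [TopologicalSpace G] [ChartedSpace R7 G] [Group G]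
  [LieGroup 𝓘(ℝ, R7) ∞ G] {K : SolvKind} (e : SolvLie K ≃ₗ⁅ℝ⁆ GroupLieAlgebra 𝓘(ℝ, R7) G)

theorem coadjoint_mul (g h : G) (F : Module.Dual ℝ (GroupLieAlgebra 𝓘(ℝ, R7) G)) :
    coadjoint (g * h) F = coadjoint g (coadjoint h F) := by
  have h1 := coordAd_mul h⁻¹ g⁻¹
  rw [← mul_inv_rev] at h1
  ext v
  exact congrArg (fun T : R7 →L[ℝ] R7 => F (T v)) h1

theorem coadjoint_one (F : Module.Dual ℝ (GroupLieAlgebra 𝓘(ℝ, R7) G)) :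
    coadjoint 1 F = F := by
  have h1 := coordAd_one (G := G)
  rw [← inv_one] at h1
  ext v
  exact congrArg (fun T : R7 →L[ℝ] R7 => F (T v)) h1

theorem mem_coadjointOrbit_self (F : Module.Dual ℝ (GroupLieAlgebra 𝓘(ℝ, R7) G)) :
    F ∈ coadjointOrbit F :=
  ⟨1, coadjoint_one F⟩

theorem coadjointOrbit_eq_of_mem {F F' : Module.Dual ℝ (GroupLieAlgebra 𝓘(ℝ, R7) G)}
    (h : F' ∈ coadjointOrbit F) : coadjointOrbit F' = coadjointOrbit F := by
  obtain ⟨g, rfl⟩ := h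
  ext F''
  constructor
  · rintro ⟨k, rfl⟩
    exact ⟨k * g, coadjoint_mul k g F⟩
  · rintro ⟨k, rfl⟩
    refine ⟨k * g⁻¹, ?_⟩
    change coadjoint (k * g⁻¹) (coadjoint g F) = coadjoint k F
    rw [← coadjoint_mul, inv_mul_cancel_right]

/-- An orbit whose tangent space projects onto `V` projects onto a neighbourhood. -/
theorem image_coadjointOrbit_mem_nhds {V : Type*} [NormedAddCommGroup V] [NormedSpace ℝ V]
    [CompleteSpace V] (π : (Fin 7 → ℝ) →L[ℝ] V)
    (F : Module.Dual ℝ (GroupLieAlgebra 𝓘(ℝ, R7) G))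
    (h : ∀ y, ∃ u, π (coadMap K (dualCoords e F) u) = y) :
    (fun F' => π (dualCoords e F')) '' coadjointOrbit F ∈ 𝓝 (π (dualCoords e F)) := by
  have h1 : HasStrictFDerivAt (chartAd G) (frameBracket (chartMul G) (unitCoord G))
      (unitCoord G) :=
    contDiffAt_chartAd.hasStrictFDerivAt' hasFDerivAt_chartAd (by norm_num)
  -- The map `g ↦ π (K(g⁻¹) F)` in the chart is a submersion at the identity, so it maps
  -- neighbourhoods onto neighbourhoods.
  have h2 : HasStrictFDerivAt (fun x => π (compCoords e F (chartAd G x)))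
      ((π.comp (compCoords e F)).comp (frameBracket (chartMul G) (unitCoord G))) (unitCoord G) :=
    HasStrictFDerivAt.comp (unitCoord G) (π.comp (compCoords e F)).hasStrictFDerivAt h1
  have h3 : ((π.comp (compCoords e F)).comp (frameBracket (chartMul G) (unitCoord G))).range
      = ⊤ := by
    rw [LinearMap.range_eq_top]
    intro y
    obtain ⟨u, hu⟩ := h y
    refine ⟨(lieCoords e).symm u, ?_⟩
    have := compCoords_frameBracket e F ((lieCoords e).symm u)
    rw [LinearEquiv.apply_symm_apply] at this
    rw [← hu, ← this]
    rfl
  have h4 := h2.map_nhds_eq_of_surj h3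
  have h5 : compCoords e F (chartAd G (unitCoord G)) = dualCoords e F := by
    rw [chartAd, ofCoord_unitCoord, compCoords_coordAd, inv_one, coadjoint_one]
  rw [h5] at h4
  rw [← h4, mem_map]
  refine univ_mem' fun x => ⟨coadjoint (ofCoord G x)⁻¹ F, mem_range_self _, ?_⟩
  change π (dualCoords e (coadjoint (ofCoord G x)⁻¹ F)) = π (compCoords e F (chartAd G x))
  rw [chartAd, compCoords_coordAd]

/-- A set is stable under the flows of all time-dependent infinitesimal coadjoint actions. -/
def IsFlowInvariant (K : SolvKind) (S : Set (Fin 7 → ℝ)) : Prop :=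
  ∀ u x : ℝ → Fin 7 → ℝ, Continuous u →
    (∀ t, HasDerivAt x (coadMap K (x t) (u t)) t) → x 0 ∈ S → ∀ t, x t ∈ S

/-- Any element near the identity is joined to it by a path `γ` in the chart. Then `F ∘ Ad(γ)` has
derivative `F ∘ Ad(γ) ∘ ad(ξ)`, with `ξ` the velocity of `γ` in the left frame, and so is a
trajectory of the kind that preserves `S`. -/
theorem eventually_coadjoint_mem_of_isFlowInvariant {S : Set (Fin 7 → ℝ)}
    (hS : IsFlowInvariant K S) :
    ∀ᶠ g in 𝓝 (1 : G), ∀ F : Module.Dual ℝ (GroupLieAlgebra 𝓘(ℝ, R7) G),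
      dualCoords e F ∈ S → dualCoords e (coadjoint g⁻¹ F) ∈ S := by
  have hcont : ∀ᶠ x in 𝓝 (unitCoord G), ContinuousAt
      (fun x => (leftFrame (chartMul G) (unitCoord G) x).inverse) x := by
    have h := contDiffAt_inverse_of_eq_id
      (contDiffAt_leftFrame (contDiffAt_chartMul_unit (G := G)))
      (leftFrame_self contDiffAt_chartMul_unit eventually_chartMul_unit_left)
    filter_upwards [h.eventually (by simp)] with x hx using hx.continuousAt
  obtain ⟨r, hr, hball⟩ := Metric.eventually_nhds_iff_ball.1
    ((eventually_hasFDerivAt_chartAd (G := G)).and hcont)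
  rw [← map_ofCoord_nhds, eventually_map]
  filter_upwards [Metric.ball_mem_nhds _ hr] with q hq F hF
  set w : R7 := q - unitCoord G with hw
  -- Flow invariance concerns trajectories defined for all real times. The sine keeps the path in
  -- the ball forever and brings it to `q` at time `π / 2`.
  let γ : ℝ → R7 := fun t => unitCoord G + Real.sin t • w
  have hγ : ∀ t, γ t ∈ Metric.ball (unitCoord G) r := by
    intro t
    rw [mem_ball_iff_norm] at hq ⊢
    simp only [γ, add_sub_cancel_left, norm_smul]
    refine lt_of_le_of_lt ?_ hq
    rw [← hw]
    exact mul_le_of_le_one_left (norm_nonneg _) (Real.abs_sin_le_one t)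
  have hγ' : ∀ t, HasDerivAt γ (Real.cos t • w) t := fun t =>
    ((Real.hasDerivAt_sin t).smul_const w).const_add _
  have hγc : Continuous γ := continuous_iff_continuousAt.2 fun t => (hγ' t).continuousAt
  let ξ : ℝ → R7 := fun t =>
    (leftFrame (chartMul G) (unitCoord G) (γ t)).inverse (Real.cos t • w)
  have hξ : Continuous ξ := by
    refine Continuous.clm_apply ?_ (Real.continuous_cos.smul continuous_const)
    exact continuous_iff_continuousAt.2 fun t =>
      ContinuousAt.comp (f := γ) (hball _ (hγ t)).2 hγc.continuousAt
  have h0 : γ 0 = unitCoord G := by simp [γ]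
  have h1 : γ (Real.pi / 2) = q := by simp [γ, hw]
  have key := hS (fun t => lieCoords e (ξ t)) (fun t => compCoords e F (chartAd G (γ t)))
    ((LinearMap.continuous_of_finiteDimensional (lieCoords e).toLinearMap).comp hξ) ?_ ?_
    (Real.pi / 2)
  · simpa only [h1, chartAd, compCoords_coordAd] using key
  · intro t
    have hd : HasDerivAt (fun t => chartAd G (γ t)) _ t :=
      HasFDerivAt.comp_hasDerivAt (l := chartAd G) (f := γ) t (hball _ (hγ t)).1 (hγ' t)
    have hd' := (compCoords e F).hasFDerivAt.comp_hasDerivAt t hd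
    have e1 : coadMap K (compCoords e F (chartAd G (γ t))) (lieCoords e (ξ t)) =
        compCoords e F (((ContinuousLinearMap.compL ℝ R7 R7 R7 (chartAd G (γ t))).comp
          ((frameBracket (chartMul G) (unitCoord G)).comp
            (leftFrame (chartMul G) (unitCoord G) (γ t)).inverse)) (Real.cos t • w)) :=
      (compCoords_frameBracket e (F.comp (chartAd G (γ t) : R7 →ₗ[ℝ] R7)) (ξ t)).symm
    change HasDerivAt _ (coadMap K (compCoords e F (chartAd G (γ t))) (lieCoords e (ξ t))) t
    rw [e1]
    exact hd'
  · rw [h0, chartAd_unitCoord]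
    exact hF

theorem coadjointOrbit_subset_of_isFlowInvariant [ConnectedSpace G] {S : Set (Fin 7 → ℝ)}
    (hS : IsFlowInvariant K S) {F : Module.Dual ℝ (GroupLieAlgebra 𝓘(ℝ, R7) G)}
    (hF : dualCoords e F ∈ S) : coadjointOrbit F ⊆ dualCoords e ⁻¹' S := by
  have : IsTopologicalGroup G := topologicalGroup_of_lieGroup 𝓘(ℝ, R7) ∞
  -- The stabiliser of `S` contains a neighbourhood of the identity, so it is an open, hence closed,
  -- subgroup of a connected group. The equivalence in the carrier makes it stable under inverses.
  let H : Subgroup G :=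
    { carrier := {g | ∀ F : Module.Dual ℝ (GroupLieAlgebra 𝓘(ℝ, R7) G),
        dualCoords e (coadjoint g F) ∈ S ↔ dualCoords e F ∈ S}
      one_mem' := fun F => by rw [coadjoint_one]
      mul_mem' := fun {g h} hg hh F => by rw [coadjoint_mul, hg, hh]
      inv_mem' := fun {g} hg F => by
        rw [← hg, ← coadjoint_mul, mul_inv_cancel, coadjoint_one] }
  have hev := eventually_coadjoint_mem_of_isFlowInvariant e hS
  have hev' : ∀ᶠ g in 𝓝 (1 : G), ∀ F : Module.Dual ℝ (GroupLieAlgebra 𝓘(ℝ, R7) G),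
      dualCoords e F ∈ S → dualCoords e (coadjoint g F) ∈ S := by
    have h := (continuous_inv (G := G)).tendsto 1
    rw [inv_one] at h
    filter_upwards [h.eventually hev] with g hg
    simpa using hg
  have hH : (H : Set G) ∈ 𝓝 (1 : G) := by
    filter_upwards [hev, hev'] with g hg hg' F
    refine ⟨fun h => ?_, hg' F⟩
    have := hg _ h
    rwa [← coadjoint_mul, inv_mul_cancel, coadjoint_one] at this
  have hopen : IsOpen (H : Set G) := Subgroup.isOpen_of_mem_nhds H hH
  have htop : (H : Set G) = univ :=
    IsClopen.eq_univ ⟨H.isClosed_of_isOpen hopen, hopen⟩ ⟨1, H.one_mem⟩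
  rintro _ ⟨g, rfl⟩
  have hg : g ∈ (H : Set G) := htop ▸ mem_univ g
  exact (hg F).2 hF

/-- A flow-invariant set that projects injectively onto a connected set is a single orbit when
the tangent spaces of the orbits project onto everything. -/
theorem coadjointOrbit_eq_preimage [ConnectedSpace G] {V : Type*} [NormedAddCommGroup V]
    [NormedSpace ℝ V] [CompleteSpace V] (π : (Fin 7 → ℝ) →L[ℝ] V) {S : Set (Fin 7 → ℝ)}
    (hS : IsFlowInvariant K S) (hinj : InjOn π S) (hconn : IsPreconnected (π '' S))
    (hsurj : ∀ x ∈ S, ∀ y, ∃ u, π (coadMap K x u) = y)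
    {F : Module.Dual ℝ (GroupLieAlgebra 𝓘(ℝ, R7) G)} (hF : dualCoords e F ∈ S) :
    coadjointOrbit F = dualCoords e ⁻¹' S := by
  refine (coadjointOrbit_subset_of_isFlowInvariant e hS hF).antisymm ?_
  let O : Module.Dual ℝ (GroupLieAlgebra 𝓘(ℝ, R7) G) → Set V :=
    fun F' => (fun F' => π (dualCoords e F')) '' coadjointOrbit F'
  have hO : ∀ F', dualCoords e F' ∈ S → IsOpen (O F') := by
    intro F' hF'
    rw [isOpen_iff_mem_nhds]
    rintro _ ⟨F'', h'', rfl⟩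
    have := image_coadjointOrbit_mem_nhds e π F''
      (hsurj _ (coadjointOrbit_subset_of_isFlowInvariant e hS hF' h''))
    rwa [coadjointOrbit_eq_of_mem h''] at this
  intro F₁ hF₁
  by_contra hne
  -- If `S` held a second orbit, the projections of the given orbit and of all the others would be
  -- two nonempty open sets covering the connected set `π '' S`, so they would meet.
  let W : Set V := ⋃ F' ∈ {F' | dualCoords e F' ∈ S ∧ F' ∉ coadjointOrbit F}, O F'
  have hW : IsOpen W := isOpen_biUnion fun F' hF' => hO F' hF'.1
  have hcover : π '' S ⊆ O F ∪ W := by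
    rintro _ ⟨x, hx, rfl⟩
    obtain ⟨F', rfl⟩ := dualCoords_surjective e x
    by_cases h : F' ∈ coadjointOrbit F
    · exact Or.inl ⟨F', h, rfl⟩
    · exact Or.inr (mem_biUnion (show F' ∈ {F' | _ ∧ _} from ⟨hx, h⟩)
        ⟨F', mem_coadjointOrbit_self F', rfl⟩)
  obtain ⟨_, _, ⟨F₂, h₂, rfl⟩, hz⟩ := hconn (O F) W (hO F hF) hW hcover
    ⟨_, mem_image_of_mem π hF, F, mem_coadjointOrbit_self F, rfl⟩
    ⟨_, mem_image_of_mem π hF₁, mem_biUnion (show F₁ ∈ {F' | _ ∧ _} from ⟨hF₁, hne⟩)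
      ⟨F₁, mem_coadjointOrbit_self F₁, rfl⟩⟩
  obtain ⟨F₃, ⟨h₃, h₃'⟩, F₄, h₄, h₄'⟩ := mem_iUnion₂.1 hz
  -- A common point of the projections lifts uniquely to `S`, so two distinct orbits would share a
  -- point.
  have h₅ : F₄ = F₂ := dualCoords_injective e (hinj
    (coadjointOrbit_subset_of_isFlowInvariant e hS h₃ h₄)
    (coadjointOrbit_subset_of_isFlowInvariant e hS hF h₂) h₄')
  rw [h₅] at h₄
  exact h₃' (coadjointOrbit_eq_of_mem h₂ ▸ coadjointOrbit_eq_of_mem h₄ ▸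
    mem_coadjointOrbit_self F₃)

/-- Forgetting one coordinate. -/
noncomputable def dropCoord (j : Fin 7) : (Fin 7 → ℝ) →L[ℝ] (Fin 6 → ℝ) :=
  ContinuousLinearMap.pi fun i => ContinuousLinearMap.proj (j.succAbove i)

theorem dropCoord_eq_iff {j : Fin 7} {x y : Fin 7 → ℝ} :
    dropCoord j x = dropCoord j y ↔ ∀ i, i ≠ j → x i = y i := by
  constructor
  · intro h i hi
    obtain ⟨k, rfl⟩ := Fin.exists_succAbove_eq hi
    exact congrFun h k
  · intro h
    ext i
    exact h _ (Fin.succAbove_ne j i)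

/-- Forgetting the `j`-th coordinate is injective on a graph `x j = f x`. The image is cut out by
two sign conditions, hence convex and connected. -/
theorem coadjointOrbit_eq_graph [ConnectedSpace G] (j k l : Fin 7) (hk : k ≠ j) (hl : l ≠ j)
    {f : (Fin 7 → ℝ) → ℝ} (hf : ∀ x y, (∀ i, i ≠ j → x i = y i) → f x = f y) {a b : ℝ}
    (hS : IsFlowInvariant K {x | x j = f x ∧ 0 < a * x k ∧ 0 < b * x l})
    (hsurj : ∀ x, x j = f x → 0 < a * x k → 0 < b * x l → ∀ y : Fin 7 → ℝ,
      ∃ u, ∀ i, i ≠ j → coadMap K x u i = y i)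
    {F : Module.Dual ℝ (GroupLieAlgebra 𝓘(ℝ, R7) G)}
    (hF : dualCoords e F ∈ {x | x j = f x ∧ 0 < a * x k ∧ 0 < b * x l}) :
    coadjointOrbit F = dualCoords e ⁻¹' {x | x j = f x ∧ 0 < a * x k ∧ 0 < b * x l} := by
  have himage : dropCoord j '' {x | x j = f x ∧ 0 < a * x k ∧ 0 < b * x l} =
      dropCoord j '' {x | 0 < a * x k ∧ 0 < b * x l} := by
    refine (image_mono fun x hx => hx.2).antisymm ?_
    rintro _ ⟨x, hx, rfl⟩
    refine ⟨Function.update x j (f x), ⟨?_, ?_, ?_⟩, ?_⟩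
    · rw [Function.update_self]
      exact hf _ _ fun i hi => (Function.update_of_ne hi _ _).symm
    · rw [Function.update_of_ne hk]; exact hx.1
    · rw [Function.update_of_ne hl]; exact hx.2
    · exact dropCoord_eq_iff.2 fun i hi => Function.update_of_ne hi _ _
  refine coadjointOrbit_eq_preimage e (dropCoord j) hS ?_ ?_ ?_ hF
  · intro x hx y hy hxy
    rw [dropCoord_eq_iff] at hxy
    ext i
    by_cases hi : i = j
    · rw [hi, hx.1, hy.1, hf x y hxy]
    · exact hxy i hi
  · rw [himage]
    refine Convex.isPreconnected (Convex.is_linear_image ?_ (dropCoord j).toLinearMap.isLinear)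
    refine Convex.inter (s := {x : Fin 7 → ℝ | 0 < a * x k}) (t := {x | 0 < b * x l}) ?_ ?_
    · exact convex_halfSpace_gt (IsLinearMap.mk (fun x y => by simp [mul_add])
        fun c x => by simp [mul_left_comm]) 0
    · exact convex_halfSpace_gt (IsLinearMap.mk (fun x y => by simp [mul_add])
        fun c x => by simp [mul_left_comm]) 0
  · intro x hx y
    -- The inserted value `0` is arbitrary, since the `j`-th coordinate is not prescribed.
    obtain ⟨u, hu⟩ := hsurj x hx.1 hx.2.1 hx.2.2 (j.insertNth 0 y)
    refine ⟨u, ?_⟩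
    ext i
    exact (hu _ (Fin.succAbove_ne j i)).trans (by simp)

end Orbits

/-! ### Scalar linear differential equations -/

section Flow

/-- Multiplying by the integrating factor `exp (-∫ a)` gives a constant. Consequently solutions
never change sign and vanish identically if they vanish once. -/
theorem eq_mul_exp_of_hasDerivAt {a c : ℝ → ℝ} (ha : Continuous a)
    (hc : ∀ t, HasDerivAt c (a t * c t) t) (t : ℝ) : c t = c 0 * Real.exp (∫ s in (0)..t, a s) := by
  have hb : ∀ t, HasDerivAt (fun t => ∫ s in (0)..t, a s) (a t) t := fun t =>
    ha.integral_hasStrictDerivAt 0 t |>.hasDerivAt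
  have h : ∀ t, HasDerivAt (fun t => c t * Real.exp (-∫ s in (0)..t, a s)) 0 t := by
    intro t
    refine ((hc t).mul (hb t).neg.exp).congr_deriv ?_
    ring
  have h0 := is_const_of_deriv_eq_zero (fun t => (h t).differentiableAt) (fun t => (h t).deriv) t 0
  simp only [intervalIntegral.integral_same, neg_zero, Real.exp_zero, mul_one] at h0
  rw [← h0, mul_assoc, ← Real.exp_add, neg_add_cancel, Real.exp_zero, mul_one]

theorem mul_pos_of_hasDerivAt {a c : ℝ → ℝ} (ha : Continuous a)
    (hc : ∀ t, HasDerivAt c (a t * c t) t) {α : ℝ} (h0 : 0 < α * c 0) (t : ℝ) : 0 < α * c t := by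
  rw [eq_mul_exp_of_hasDerivAt ha hc t, ← mul_assoc]
  exact mul_pos h0 (Real.exp_pos _)

theorem eq_zero_of_hasDerivAt {a c : ℝ → ℝ} (ha : Continuous a)
    (hc : ∀ t, HasDerivAt c (a t * c t) t) (h0 : c 0 = 0) (t : ℝ) : c t = 0 := by
  rw [eq_mul_exp_of_hasDerivAt ha hc t, h0, zero_mul]

end Flow

/-! ### The two shapes of orbits, and the rank of `coadMap` -/

section Orbits

variable {G : Type*} [TopologicalSpace G] [ChartedSpace R7 G] [Group G]
  [LieGroup 𝓘(ℝ, R7) ∞ G] {K : SolvKind} (e : SolvLie K ≃ₗ⁅ℝ⁆ GroupLieAlgebra 𝓘(ℝ, R7) G)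

/-- The infinitesimal coadjoint action at `x` reaches all values of the coordinates other than
the `j`-th one. -/
def CoadOnto (K : SolvKind) (j : Fin 7) (x : Fin 7 → ℝ) : Prop :=
  ∀ y : Fin 7 → ℝ, ∃ u, ∀ i, i ≠ j → coadMap K x u i = y i

/-- The hyperplane case: `x j` solves a homogeneous linear equation and stays zero, after which `x
k` and `x l` do the same and keep their signs. -/
theorem coadjointOrbit_eq_of_vanishing [ConnectedSpace G] (j k l : Fin 7) (hk : k ≠ j)
    (hl : l ≠ j) {p q r : (Fin 7 → ℝ) → ℝ} (hp : Continuous p) (hq : Continuous q)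
    (hr : Continuous r) (hj : ∀ x u, coadMap K x u j = p u * x j)
    (hxk : ∀ x u, x j = 0 → coadMap K x u k = q u * x k)
    (hxl : ∀ x u, x j = 0 → coadMap K x u l = r u * x l)
    (hsurj : ∀ x, x j = 0 → x k ≠ 0 → x l ≠ 0 → CoadOnto K j x)
    {F : Module.Dual ℝ (GroupLieAlgebra 𝓘(ℝ, R7) G)}
    (hFj : dualCoords e F j = 0) (hFk : dualCoords e F k ≠ 0) (hFl : dualCoords e F l ≠ 0) :
    coadjointOrbit F = dualCoords e ⁻¹'
      {x | x j = 0 ∧ 0 < dualCoords e F k * x k ∧ 0 < dualCoords e F l * x l} := by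
  refine coadjointOrbit_eq_graph e j k l hk hl (f := fun _ => 0) (fun _ _ _ => rfl) ?_ ?_
    ⟨hFj, mul_self_pos.2 hFk, mul_self_pos.2 hFl⟩
  · rintro u x hu hx ⟨h0, h1, h2⟩ t
    have hx' : ∀ i t, HasDerivAt (fun s => x s i) (coadMap K (x t) (u t) i) t := fun i t =>
      hasDerivAt_pi.1 (hx t) i
    have hz := eq_zero_of_hasDerivAt (hp.comp hu) (c := fun s => x s j) (fun t => by
      simpa only [hj, Function.comp_apply] using hx' j t) h0
    refine ⟨hz t, ?_, ?_⟩
    · refine mul_pos_of_hasDerivAt (hq.comp hu) (c := fun s => x s k) (fun t => ?_) h1 t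
      have := hx' k t
      rwa [hxk _ _ (hz t)] at this
    · refine mul_pos_of_hasDerivAt (hr.comp hu) (c := fun s => x s l) (fun t => ?_) h2 t
      have := hx' l t
      rwa [hxl _ _ (hz t)] at this
  · intro x h0 h1 h2
    exact hsurj x h0 (right_ne_zero_of_mul h1.ne') (right_ne_zero_of_mul h2.ne')

/-- The generic case: `I` is a first integral where `x k` and `x l` do not vanish, and its level set
there can be solved for `x j`, hence is a graph. -/
theorem coadjointOrbit_eq_levelSet [ConnectedSpace G] (j k l : Fin 7) (hk : k ≠ j)
    (hl : l ≠ j) {q r : (Fin 7 → ℝ) → ℝ} (hq : Continuous q)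
    (hr : Continuous r)
    (hxk : ∀ x u, coadMap K x u k = q u * x k)
    (hxl : ∀ x u, coadMap K x u l = r u * x l)
    {I f : (Fin 7 → ℝ) → ℝ} (hf : ∀ x y, (∀ i, i ≠ j → x i = y i) → f x = f y)
    {c : ℝ} (hIf : ∀ x, x k ≠ 0 → x l ≠ 0 → (I x = c ↔ x j = f x))
    (hI : ∀ (u : Fin 7 → ℝ) (x : ℝ → Fin 7 → ℝ) (t : ℝ), x t k ≠ 0 → x t l ≠ 0 →
      (∀ i, HasDerivAt (fun s => x s i) (coadMap K (x t) u i) t) →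
      HasDerivAt (fun s => I (x s)) 0 t)
    (hsurj : ∀ x, x k ≠ 0 → x l ≠ 0 → CoadOnto K j x)
    {F : Module.Dual ℝ (GroupLieAlgebra 𝓘(ℝ, R7) G)}
    (hFj : I (dualCoords e F) = c) (hFk : dualCoords e F k ≠ 0) (hFl : dualCoords e F l ≠ 0) :
    coadjointOrbit F = dualCoords e ⁻¹'
      {x | I x = c ∧ 0 < dualCoords e F k * x k ∧ 0 < dualCoords e F l * x l} := by
  have hset : {x | I x = c ∧ 0 < dualCoords e F k * x k ∧ 0 < dualCoords e F l * x l} =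
      {x | x j = f x ∧ 0 < dualCoords e F k * x k ∧ 0 < dualCoords e F l * x l} := by
    ext x
    exact and_congr_left fun h =>
      hIf x (right_ne_zero_of_mul h.1.ne') (right_ne_zero_of_mul h.2.ne')
  rw [hset]
  refine coadjointOrbit_eq_graph e j k l hk hl hf ?_ ?_
    ⟨(hIf _ hFk hFl).1 hFj, mul_self_pos.2 hFk, mul_self_pos.2 hFl⟩
  · rw [← hset]
    rintro u x hu hx ⟨h0, h1, h2⟩ t
    have hx' : ∀ i t, HasDerivAt (fun s => x s i) (coadMap K (x t) (u t) i) t := fun i t =>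
      hasDerivAt_pi.1 (hx t) i
    have h1' := mul_pos_of_hasDerivAt (hq.comp hu) (c := fun s => x s k) (fun t => by
      simpa only [hxk, Function.comp_apply] using hx' k t) h1
    have h2' := mul_pos_of_hasDerivAt (hr.comp hu) (c := fun s => x s l) (fun t => by
      simpa only [hxl, Function.comp_apply] using hx' l t) h2
    refine ⟨?_, h1' t, h2' t⟩
    have hd : ∀ t, HasDerivAt (fun s => I (x s)) 0 t := fun t =>
      hI (u t) x t (right_ne_zero_of_mul (h1' t).ne') (right_ne_zero_of_mul (h2' t).ne')
        fun i => hx' i t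
    rw [← h0]
    exact is_const_of_deriv_eq_zero (fun t => (hd t).differentiableAt) (fun t => (hd t).deriv) t 0
  · intro x _ h1 h2
    exact hsurj x (right_ne_zero_of_mul h1.ne') (right_ne_zero_of_mul h2.ne')

theorem coadMap_single_skew (K : SolvKind) (x : Fin 7 → ℝ) (i k : Fin 7) :
    coadMap K x (Pi.single k 1) i = -coadMap K x (Pi.single i 1) k := by
  have h : solvBracket K (Pi.single k 1) (Pi.single i 1) =
      -solvBracket K (Pi.single i 1) (Pi.single k 1) :=
    (lie_skew (L := SolvLie K) (SolvLie.vec K k) (SolvLie.vec K i)).symm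
  simp only [coadMap, LinearMap.coe_mk, AddHom.coe_mk]
  rw [h]
  simp

theorem finrank_range_coadMap_le (K : SolvKind) (x : Fin 7 → ℝ) :
    Module.finrank ℝ (LinearMap.range (coadMap K x)) ≤ 6 := by
  have hskew : (LinearMap.toMatrix' (coadMap K x)).transpose =
      -LinearMap.toMatrix' (coadMap K x) := by
    ext i k
    simpa [LinearMap.toMatrix'_apply] using coadMap_single_skew K x k i
  -- A skew matrix of size 7 has `det M = (-1) ^ 7 * det M`.
  have hdet : (LinearMap.toMatrix' (coadMap K x)).det = 0 := by
    have h := congrArg Matrix.det hskew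
    rw [Matrix.det_transpose, Matrix.det_neg] at h
    simp only [Fintype.card_fin] at h
    linarith
  obtain ⟨v, hv, hv0⟩ := Matrix.exists_mulVec_eq_zero_iff.2 hdet
  rw [LinearMap.toMatrix'_mulVec] at hv0
  have hker : 0 < Module.finrank ℝ (LinearMap.ker (coadMap K x)) :=
    Module.finrank_pos_iff_exists_ne_zero.2 ⟨⟨v, hv0⟩, fun h => hv (congrArg Subtype.val h)⟩
  have := LinearMap.finrank_range_add_finrank_ker (coadMap K x)
  rw [Module.finrank_fin_fun] at this
  omega

theorem finrank_range_coadMap_eq {K : SolvKind} {j : Fin 7} {x : Fin 7 → ℝ}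
    (h : CoadOnto K j x) : Module.finrank ℝ (LinearMap.range (coadMap K x)) = 6 := by
  refine (finrank_range_coadMap_le K x).antisymm ?_
  have hs : LinearMap.range ((dropCoord j).toLinearMap.comp (coadMap K x)) = ⊤ := by
    rw [LinearMap.range_eq_top]
    intro y
    obtain ⟨u, hu⟩ := h (j.insertNth 0 y)
    refine ⟨u, ?_⟩
    ext i
    exact (hu _ (Fin.succAbove_ne j i)).trans (by simp)
  have h1 := Submodule.finrank_map_le (dropCoord j).toLinearMap (LinearMap.range (coadMap K x))
  rw [← LinearMap.range_comp, hs, finrank_top, Module.finrank_fin_fun] at h1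
  exact h1

/-- By skew-symmetry, a coordinate that vanishes on the whole range puts its basis vector in the
kernel. Two of them make the kernel at least two-dimensional. -/
theorem finrank_range_coadMap_ne {K : SolvKind} {x : Fin 7 → ℝ} (i j : Fin 7) (hij : i ≠ j)
    (hi : ∀ u, coadMap K x u i = 0) (hj : ∀ u, coadMap K x u j = 0) :
    Module.finrank ℝ (LinearMap.range (coadMap K x)) ≠ 6 := by
  have hker : ∀ k, (∀ u, coadMap K x u k = 0) →
      (Pi.single k 1 : Fin 7 → ℝ) ∈ LinearMap.ker (coadMap K x) := by
    intro k hk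
    rw [LinearMap.mem_ker]
    ext m
    rw [coadMap_single_skew, hk]
    simp
  have hli : LinearIndependent ℝ
      ![(⟨_, hker i hi⟩ : LinearMap.ker (coadMap K x)), ⟨_, hker j hj⟩] := by
    rw [LinearIndependent.pair_iff]
    intro s t hst
    have h := congrArg Subtype.val hst
    have h1 := congrFun h i
    have h2 := congrFun h j
    simp [hij, hij.symm] at h1 h2
    exact ⟨h1, h2⟩
  have h2 := hli.fintype_card_le_finrank
  have := LinearMap.finrank_range_add_finrank_ker (coadMap K x)
  rw [Module.finrank_fin_fun] at this
  rw [Fintype.card_fin] at h2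
  omega

end Orbits

/-! ### `coadMap` for each family -/

section Families

theorem coadMap_g2 (x u : Fin 7 → ℝ) : coadMap .g2 x u =
    ![u 5 * x 0 - u 1 * x 3 - u 2 * x 4, u 0 * x 3, u 0 * x 4 + u 6 * x 2, u 5 * x 3,
      (u 5 + u 6) * x 4, -(u 0 * x 0 + u 3 * x 3 + u 4 * x 4), -(u 2 * x 2 + u 4 * x 4)] := by
  ext i
  simp only [coadMap, LinearMap.coe_mk, AddHom.coe_mk, solvBracket_g2]
  fin_cases i <;> simp [Fin.sum_univ_seven] <;> ring

theorem coadMap_g3 (x u : Fin 7 → ℝ) : coadMap .g3 x u =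
    ![-(u 1 * x 3 + u 2 * x 4), u 0 * x 3 + u 5 * x 1, u 0 * x 4 + u 6 * x 2, u 5 * x 3,
      u 6 * x 4, -(u 1 * x 1 + u 3 * x 3), -(u 2 * x 2 + u 4 * x 4)] := by
  ext i
  simp only [coadMap, LinearMap.coe_mk, AddHom.coe_mk, solvBracket_g3]
  fin_cases i <;> simp [Fin.sum_univ_seven] <;> ring

theorem coadMap_g4 (x u : Fin 7 → ℝ) : coadMap .g4 x u =
    ![u 5 * x 0 - u 1 * x 3 - u 2 * x 4, u 0 * x 3 + u 6 * x 1, u 0 * x 4, (u 5 + u 6) * x 3,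
      u 5 * x 4, -(u 0 * x 0 + u 3 * x 3 + u 4 * x 4), -(u 1 * x 1 + u 3 * x 3)] := by
  ext i
  simp only [coadMap, LinearMap.coe_mk, AddHom.coe_mk, solvBracket_g4]
  fin_cases i <;> simp [Fin.sum_univ_seven] <;> ring

theorem coadMap_g9 (x u : Fin 7 → ℝ) : coadMap .g9 x u =
    ![-(u 1 * x 3 + u 2 * x 4), u 0 * x 3 + u 6 * x 1, u 0 * x 4 + u 5 * x 2 + u 6 * x 4,
      u 6 * x 3, u 5 * x 4, -(u 2 * x 2 + u 4 * x 4),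
      -(u 1 * x 1 + u 3 * x 3 + u 2 * x 4)] := by
  ext i
  simp only [coadMap, LinearMap.coe_mk, AddHom.coe_mk, solvBracket_g9]
  fin_cases i <;> simp [Fin.sum_univ_seven] <;> ring

theorem coadMap_g10 (lam : ℝ) (x u : Fin 7 → ℝ) : coadMap (.g10 lam) x u =
    ![-(u 1 * x 3 + u 2 * x 4), u 0 * x 3 + u 5 * x 1,
      u 0 * x 4 + lam * u 5 * x 2 + u 6 * (x 2 + x 4), u 5 * x 3, (lam * u 5 + u 6) * x 4,
      -(u 1 * x 1 + u 3 * x 3 + lam * (u 2 * x 2 + u 4 * x 4)),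
      -(u 2 * (x 2 + x 4) + u 4 * x 4)] := by
  ext i
  simp only [coadMap, LinearMap.coe_mk, AddHom.coe_mk, solvBracket_g10]
  fin_cases i <;> simp [Fin.sum_univ_seven, -mul_eq_mul_right_iff] <;> ring

end Families

/-! ### Solving for six coordinates of `coadMap` -/

section Surjectivity

theorem exists_mul_eq {a : ℝ} (b : ℝ) (h : a ≠ 0) : ∃ s, s * a = b :=
  ⟨b / a, div_mul_cancel₀ b h⟩

/-- The six equations form a triangular system: solved in the order below, each brings one new
unknown with a nonzero coefficient. One component of `u` is superfluous and set to zero. The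
analogues for the other families work in the same way. -/
theorem coadOnto_g2 {x : Fin 7 → ℝ} (h₃ : x 3 ≠ 0) (h₄ : x 4 ≠ 0) :
    CoadOnto .g2 1 x := by
  intro y
  obtain ⟨v, h_v⟩ := exists_mul_eq (y 3) h₃
  obtain ⟨w, h_w⟩ := exists_mul_eq (y 4 - v * x 4) h₄
  obtain ⟨a, h_a⟩ := exists_mul_eq (y 2 - w * x 2) h₄
  obtain ⟨b, h_b⟩ := exists_mul_eq (v * x 0 - y 0) h₃
  obtain ⟨d, h_d⟩ := exists_mul_eq (-y 6) h₄
  obtain ⟨c, h_c⟩ := exists_mul_eq (-y 5 - a * x 0 - d * x 4) h₃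
  refine ⟨![a, b, 0, c, d, v, w], fun i hi => ?_⟩
  rw [coadMap_g2]
  fin_cases i <;> simp at hi ⊢ <;> linarith

theorem coadOnto_g2_of_eq_zero {x : Fin 7 → ℝ} (h₄ : x 4 = 0) (h₂ : x 2 ≠ 0) (h₃ : x 3 ≠ 0) :
    CoadOnto .g2 4 x := by
  intro y
  obtain ⟨v, h_v⟩ := exists_mul_eq (y 3) h₃
  obtain ⟨w, h_w⟩ := exists_mul_eq (y 2) h₂
  obtain ⟨a, h_a⟩ := exists_mul_eq (y 1) h₃
  obtain ⟨b, h_b⟩ := exists_mul_eq (v * x 0 - y 0) h₃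
  obtain ⟨d, h_d⟩ := exists_mul_eq (-y 6) h₂
  obtain ⟨c, h_c⟩ := exists_mul_eq (-y 5 - a * x 0) h₃
  refine ⟨![a, b, d, c, 0, v, w], fun i hi => ?_⟩
  rw [coadMap_g2]
  fin_cases i <;> simp [h₄] at hi ⊢ <;> linarith

theorem coadOnto_g4 {x : Fin 7 → ℝ} (h₃ : x 3 ≠ 0) (h₄ : x 4 ≠ 0) :
    CoadOnto .g4 2 x := by
  intro y
  obtain ⟨v, h_v⟩ := exists_mul_eq (y 4) h₄
  obtain ⟨w, h_w⟩ := exists_mul_eq (y 3 - v * x 3) h₃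
  obtain ⟨a, h_a⟩ := exists_mul_eq (y 1 - w * x 1) h₃
  obtain ⟨b, h_b⟩ := exists_mul_eq (v * x 0 - y 0) h₄
  obtain ⟨d, h_d⟩ := exists_mul_eq (-y 6) h₃
  obtain ⟨c, h_c⟩ := exists_mul_eq (-y 5 - a * x 0 - d * x 3) h₄
  refine ⟨![a, 0, b, d, c, v, w], fun i hi => ?_⟩
  rw [coadMap_g4]
  fin_cases i <;> simp at hi ⊢ <;> linarith

theorem coadOnto_g4_of_eq_zero {x : Fin 7 → ℝ} (h₃ : x 3 = 0) (h₁ : x 1 ≠ 0) (h₄ : x 4 ≠ 0) :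
    CoadOnto .g4 3 x := by
  intro y
  obtain ⟨v, h_v⟩ := exists_mul_eq (y 4) h₄
  obtain ⟨w, h_w⟩ := exists_mul_eq (y 1) h₁
  obtain ⟨a, h_a⟩ := exists_mul_eq (y 2) h₄
  obtain ⟨b, h_b⟩ := exists_mul_eq (v * x 0 - y 0) h₄
  obtain ⟨d, h_d⟩ := exists_mul_eq (-y 6) h₁
  obtain ⟨c, h_c⟩ := exists_mul_eq (-y 5 - a * x 0) h₄
  refine ⟨![a, d, b, 0, c, v, w], fun i hi => ?_⟩
  rw [coadMap_g4]
  fin_cases i <;> simp [h₃] at hi ⊢ <;> linarith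

theorem coadOnto_g3 {x : Fin 7 → ℝ} (h₃ : x 3 ≠ 0) (h₄ : x 4 ≠ 0) :
    CoadOnto .g3 1 x := by
  intro y
  obtain ⟨v, h_v⟩ := exists_mul_eq (y 3) h₃
  obtain ⟨w, h_w⟩ := exists_mul_eq (y 4) h₄
  obtain ⟨a, h_a⟩ := exists_mul_eq (y 2 - w * x 2) h₄
  obtain ⟨b, h_b⟩ := exists_mul_eq (-y 0) h₄
  obtain ⟨c, h_c⟩ := exists_mul_eq (-y 5) h₃
  obtain ⟨d, h_d⟩ := exists_mul_eq (-y 6 - b * x 2) h₄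
  refine ⟨![a, 0, b, c, d, v, w], fun i hi => ?_⟩
  rw [coadMap_g3]
  fin_cases i <;> simp at hi ⊢ <;> linarith

theorem coadOnto_g3_of_eq_zero_left {x : Fin 7 → ℝ} (h₃ : x 3 = 0) (h₁ : x 1 ≠ 0) (h₄ : x 4 ≠ 0) :
    CoadOnto .g3 3 x := by
  intro y
  obtain ⟨v, h_v⟩ := exists_mul_eq (y 1) h₁
  obtain ⟨w, h_w⟩ := exists_mul_eq (y 4) h₄
  obtain ⟨a, h_a⟩ := exists_mul_eq (y 2 - w * x 2) h₄
  obtain ⟨b, h_b⟩ := exists_mul_eq (-y 0) h₄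
  obtain ⟨c, h_c⟩ := exists_mul_eq (-y 5) h₁
  obtain ⟨d, h_d⟩ := exists_mul_eq (-y 6 - b * x 2) h₄
  refine ⟨![a, c, b, 0, d, v, w], fun i hi => ?_⟩
  rw [coadMap_g3]
  fin_cases i <;> simp [h₃] at hi ⊢ <;> linarith

theorem coadOnto_g3_of_eq_zero_right {x : Fin 7 → ℝ} (h₄ : x 4 = 0) (h₂ : x 2 ≠ 0) (h₃ : x 3 ≠ 0) :
    CoadOnto .g3 4 x := by
  intro y
  obtain ⟨v, h_v⟩ := exists_mul_eq (y 3) h₃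
  obtain ⟨w, h_w⟩ := exists_mul_eq (y 2) h₂
  obtain ⟨a, h_a⟩ := exists_mul_eq (y 1 - v * x 1) h₃
  obtain ⟨b, h_b⟩ := exists_mul_eq (-y 0) h₃
  obtain ⟨c, h_c⟩ := exists_mul_eq (-y 5 - b * x 1) h₃
  obtain ⟨d, h_d⟩ := exists_mul_eq (-y 6) h₂
  refine ⟨![a, b, d, c, 0, v, w], fun i hi => ?_⟩
  rw [coadMap_g3]
  fin_cases i <;> simp [h₄] at hi ⊢ <;> linarith

theorem coadOnto_g9 {x : Fin 7 → ℝ} (h₃ : x 3 ≠ 0) (h₄ : x 4 ≠ 0) :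
    CoadOnto .g9 1 x := by
  intro y
  obtain ⟨w, h_w⟩ := exists_mul_eq (y 3) h₃
  obtain ⟨v, h_v⟩ := exists_mul_eq (y 4) h₄
  obtain ⟨a, h_a⟩ := exists_mul_eq (y 2 - v * x 2 - w * x 4) h₄
  obtain ⟨b, h_b⟩ := exists_mul_eq (-y 0) h₄
  obtain ⟨d, h_d⟩ := exists_mul_eq (-y 5 - b * x 2) h₄
  obtain ⟨c, h_c⟩ := exists_mul_eq (-y 6 - b * x 4) h₃
  refine ⟨![a, 0, b, c, d, v, w], fun i hi => ?_⟩
  rw [coadMap_g9]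
  fin_cases i <;> simp at hi ⊢ <;> linarith

theorem coadOnto_g9_of_eq_zero_left {x : Fin 7 → ℝ} (h₃ : x 3 = 0) (h₁ : x 1 ≠ 0) (h₄ : x 4 ≠ 0) :
    CoadOnto .g9 3 x := by
  intro y
  obtain ⟨w, h_w⟩ := exists_mul_eq (y 1) h₁
  obtain ⟨v, h_v⟩ := exists_mul_eq (y 4) h₄
  obtain ⟨a, h_a⟩ := exists_mul_eq (y 2 - v * x 2 - w * x 4) h₄
  obtain ⟨b, h_b⟩ := exists_mul_eq (-y 0) h₄
  obtain ⟨d, h_d⟩ := exists_mul_eq (-y 5 - b * x 2) h₄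
  obtain ⟨c, h_c⟩ := exists_mul_eq (-y 6 - b * x 4) h₁
  refine ⟨![a, c, b, 0, d, v, w], fun i hi => ?_⟩
  rw [coadMap_g9]
  fin_cases i <;> simp [h₃] at hi ⊢ <;> linarith

theorem coadOnto_g9_of_eq_zero_right {x : Fin 7 → ℝ} (h₄ : x 4 = 0) (h₂ : x 2 ≠ 0) (h₃ : x 3 ≠ 0) :
    CoadOnto .g9 4 x := by
  intro y
  obtain ⟨w, h_w⟩ := exists_mul_eq (y 3) h₃
  obtain ⟨v, h_v⟩ := exists_mul_eq (y 2) h₂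
  obtain ⟨a, h_a⟩ := exists_mul_eq (y 1 - w * x 1) h₃
  obtain ⟨b, h_b⟩ := exists_mul_eq (-y 0) h₃
  obtain ⟨d, h_d⟩ := exists_mul_eq (-y 5) h₂
  obtain ⟨c, h_c⟩ := exists_mul_eq (-y 6 - b * x 1) h₃
  refine ⟨![a, b, d, c, 0, v, w], fun i hi => ?_⟩
  rw [coadMap_g9]
  fin_cases i <;> simp [h₄] at hi ⊢ <;> linarith

theorem coadOnto_g10 (lam : ℝ) {x : Fin 7 → ℝ} (h₃ : x 3 ≠ 0) (h₄ : x 4 ≠ 0) :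
    CoadOnto (.g10 lam) 1 x := by
  intro y
  obtain ⟨v, h_v⟩ := exists_mul_eq (y 3) h₃
  obtain ⟨w, h_w⟩ := exists_mul_eq (y 4 - lam * v * x 4) h₄
  obtain ⟨a, h_a⟩ := exists_mul_eq (y 2 - lam * v * x 2 - w * (x 2 + x 4)) h₄
  obtain ⟨b, h_b⟩ := exists_mul_eq (-y 0) h₄
  obtain ⟨d, h_d⟩ := exists_mul_eq (-y 6 - b * (x 2 + x 4)) h₄
  obtain ⟨c, h_c⟩ := exists_mul_eq (-y 5 - lam * (b * x 2 + d * x 4)) h₃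
  refine ⟨![a, 0, b, c, d, v, w], fun i hi => ?_⟩
  rw [coadMap_g10]
  fin_cases i <;> simp at hi ⊢ <;> linarith

theorem coadOnto_g10_of_eq_zero_left (lam : ℝ) {x : Fin 7 → ℝ} (h₃ : x 3 = 0) (h₁ : x 1 ≠ 0)
    (h₄ : x 4 ≠ 0) :
    CoadOnto (.g10 lam) 3 x := by
  intro y
  obtain ⟨v, h_v⟩ := exists_mul_eq (y 1) h₁
  obtain ⟨w, h_w⟩ := exists_mul_eq (y 4 - lam * v * x 4) h₄
  obtain ⟨a, h_a⟩ := exists_mul_eq (y 2 - lam * v * x 2 - w * (x 2 + x 4)) h₄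
  obtain ⟨b, h_b⟩ := exists_mul_eq (-y 0) h₄
  obtain ⟨d, h_d⟩ := exists_mul_eq (-y 6 - b * (x 2 + x 4)) h₄
  obtain ⟨c, h_c⟩ := exists_mul_eq (-y 5 - lam * (b * x 2 + d * x 4)) h₁
  refine ⟨![a, c, b, 0, d, v, w], fun i hi => ?_⟩
  rw [coadMap_g10]
  fin_cases i <;> simp [h₃] at hi ⊢ <;> linarith

theorem coadOnto_g10_of_eq_zero_right (lam : ℝ) {x : Fin 7 → ℝ} (h₄ : x 4 = 0) (h₂ : x 2 ≠ 0)
    (h₃ : x 3 ≠ 0) :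
    CoadOnto (.g10 lam) 4 x := by
  intro y
  obtain ⟨v, h_v⟩ := exists_mul_eq (y 3) h₃
  obtain ⟨w, h_w⟩ := exists_mul_eq (y 2 - lam * v * x 2) h₂
  obtain ⟨a, h_a⟩ := exists_mul_eq (y 1 - v * x 1) h₃
  obtain ⟨b, h_b⟩ := exists_mul_eq (-y 0) h₃
  obtain ⟨d, h_d⟩ := exists_mul_eq (-y 6) h₂
  obtain ⟨c, h_c⟩ := exists_mul_eq (-y 5 - b * x 1 - lam * d * x 2) h₃
  refine ⟨![a, b, d, c, 0, v, w], fun i hi => ?_⟩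
  rw [coadMap_g10]
  fin_cases i <;> simp [h₄] at hi ⊢ <;> linarith

end Surjectivity

/-! ### The linear forms with orbits of dimension six -/

section OrbitDimension

theorem sq_add_sq_ne_zero_iff {s t : ℝ} : s ^ 2 + t ^ 2 ≠ 0 ↔ s ≠ 0 ∨ t ≠ 0 := by
  rw [← not_iff_not]
  push Not
  constructor
  · intro h
    constructor <;> nlinarith [sq_nonneg s, sq_nonneg t]
  · rintro ⟨rfl, rfl⟩
    simp

theorem finrank_range_coadMap_g2_eq_six_iff (x : Fin 7 → ℝ) :
    Module.finrank ℝ (LinearMap.range (coadMap .g2 x)) = 6 ↔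
      x 3 ≠ 0 ∧ x 2 ^ 2 + x 4 ^ 2 ≠ 0 := by
  rw [sq_add_sq_ne_zero_iff]
  constructor
  · intro h
    by_contra hc
    have hc' : x 3 = 0 ∨ (x 2 = 0 ∧ x 4 = 0) := by tauto
    rcases hc' with h0 | ⟨h0, h0'⟩
    · exact finrank_range_coadMap_ne 1 3 (by decide)
        (fun u => by simp [coadMap_g2, h0]) (fun u => by simp [coadMap_g2, h0]) h
    · exact finrank_range_coadMap_ne 2 4 (by decide)
        (fun u => by simp [coadMap_g2, h0, h0']) (fun u => by simp [coadMap_g2, h0']) h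
  · rintro ⟨h0, h1⟩
    by_cases h2 : x 4 = 0
    · have h3 : x 2 ≠ 0 := by tauto
      exact finrank_range_coadMap_eq (coadOnto_g2_of_eq_zero h2 h3 h0)
    · exact finrank_range_coadMap_eq (coadOnto_g2 h0 h2)

theorem finrank_range_coadMap_g4_eq_six_iff (x : Fin 7 → ℝ) :
    Module.finrank ℝ (LinearMap.range (coadMap .g4 x)) = 6 ↔
      x 4 ≠ 0 ∧ x 1 ^ 2 + x 3 ^ 2 ≠ 0 := by
  rw [sq_add_sq_ne_zero_iff]
  constructor
  · intro h
    by_contra hc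
    have hc' : x 4 = 0 ∨ (x 1 = 0 ∧ x 3 = 0) := by tauto
    rcases hc' with h0 | ⟨h0, h0'⟩
    · exact finrank_range_coadMap_ne 2 4 (by decide)
        (fun u => by simp [coadMap_g4, h0]) (fun u => by simp [coadMap_g4, h0]) h
    · exact finrank_range_coadMap_ne 1 3 (by decide)
        (fun u => by simp [coadMap_g4, h0, h0']) (fun u => by simp [coadMap_g4, h0']) h
  · rintro ⟨h0, h1⟩
    by_cases h2 : x 3 = 0
    · have h3 : x 1 ≠ 0 := by tauto
      exact finrank_range_coadMap_eq (coadOnto_g4_of_eq_zero h2 h3 h0)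
    · exact finrank_range_coadMap_eq (coadOnto_g4 h2 h0)

theorem finrank_range_coadMap_g3_eq_six_iff (x : Fin 7 → ℝ) :
    Module.finrank ℝ (LinearMap.range (coadMap .g3 x)) = 6 ↔
      (x 3 = 0 ∧ x 1 * x 4 ≠ 0) ∨ (x 3 ≠ 0 ∧ x 2 ^ 2 + x 4 ^ 2 ≠ 0) := by
  rw [sq_add_sq_ne_zero_iff, mul_ne_zero_iff]
  constructor
  · intro h
    by_contra hc
    have hc' : (x 1 = 0 ∧ x 3 = 0) ∨ (x 3 = 0 ∧ x 4 = 0) ∨ (x 2 = 0 ∧ x 4 = 0) := by tauto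
    rcases hc' with ⟨h0, h0'⟩ | ⟨h0, h0'⟩ | ⟨h0, h0'⟩
    · exact finrank_range_coadMap_ne 1 3 (by decide)
        (fun u => by simp [coadMap_g3, h0, h0']) (fun u => by simp [coadMap_g3, h0']) h
    · exact finrank_range_coadMap_ne 3 4 (by decide)
        (fun u => by simp [coadMap_g3, h0]) (fun u => by simp [coadMap_g3, h0']) h
    · exact finrank_range_coadMap_ne 2 4 (by decide)
        (fun u => by simp [coadMap_g3, h0, h0']) (fun u => by simp [coadMap_g3, h0']) h
  · rintro (⟨h0, h1, h2⟩ | ⟨h0, h1⟩)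
    · exact finrank_range_coadMap_eq (coadOnto_g3_of_eq_zero_left h0 h1 h2)
    · by_cases h2 : x 4 = 0
      · have h3 : x 2 ≠ 0 := by tauto
        exact finrank_range_coadMap_eq (coadOnto_g3_of_eq_zero_right h2 h3 h0)
      · exact finrank_range_coadMap_eq (coadOnto_g3 h0 h2)

theorem finrank_range_coadMap_g9_eq_six_iff (x : Fin 7 → ℝ) :
    Module.finrank ℝ (LinearMap.range (coadMap .g9 x)) = 6 ↔
      (x 3 = 0 ∧ x 1 * x 4 ≠ 0) ∨ (x 3 ≠ 0 ∧ x 2 ^ 2 + x 4 ^ 2 ≠ 0) := by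
  rw [sq_add_sq_ne_zero_iff, mul_ne_zero_iff]
  constructor
  · intro h
    by_contra hc
    have hc' : (x 1 = 0 ∧ x 3 = 0) ∨ (x 3 = 0 ∧ x 4 = 0) ∨ (x 2 = 0 ∧ x 4 = 0) := by tauto
    rcases hc' with ⟨h0, h0'⟩ | ⟨h0, h0'⟩ | ⟨h0, h0'⟩
    · exact finrank_range_coadMap_ne 1 3 (by decide)
        (fun u => by simp [coadMap_g9, h0, h0']) (fun u => by simp [coadMap_g9, h0']) h
    · exact finrank_range_coadMap_ne 3 4 (by decide)
        (fun u => by simp [coadMap_g9, h0]) (fun u => by simp [coadMap_g9, h0']) h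
    · exact finrank_range_coadMap_ne 2 4 (by decide)
        (fun u => by simp [coadMap_g9, h0, h0']) (fun u => by simp [coadMap_g9, h0']) h
  · rintro (⟨h0, h1, h2⟩ | ⟨h0, h1⟩)
    · exact finrank_range_coadMap_eq (coadOnto_g9_of_eq_zero_left h0 h1 h2)
    · by_cases h2 : x 4 = 0
      · have h3 : x 2 ≠ 0 := by tauto
        exact finrank_range_coadMap_eq (coadOnto_g9_of_eq_zero_right h2 h3 h0)
      · exact finrank_range_coadMap_eq (coadOnto_g9 h0 h2)

theorem finrank_range_coadMap_g10_eq_six_iff (lam : ℝ) (x : Fin 7 → ℝ) :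
    Module.finrank ℝ (LinearMap.range (coadMap (.g10 lam) x)) = 6 ↔
      (x 3 = 0 ∧ x 1 * x 4 ≠ 0) ∨ (x 3 ≠ 0 ∧ x 2 ^ 2 + x 4 ^ 2 ≠ 0) := by
  rw [sq_add_sq_ne_zero_iff, mul_ne_zero_iff]
  constructor
  · intro h
    by_contra hc
    have hc' : (x 1 = 0 ∧ x 3 = 0) ∨ (x 3 = 0 ∧ x 4 = 0) ∨ (x 2 = 0 ∧ x 4 = 0) := by tauto
    rcases hc' with ⟨h0, h0'⟩ | ⟨h0, h0'⟩ | ⟨h0, h0'⟩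
    · exact finrank_range_coadMap_ne 1 3 (by decide)
        (fun u => by simp [coadMap_g10, h0, h0']) (fun u => by simp [coadMap_g10, h0']) h
    · exact finrank_range_coadMap_ne 3 4 (by decide)
        (fun u => by simp [coadMap_g10, h0]) (fun u => by simp [coadMap_g10, h0']) h
    · exact finrank_range_coadMap_ne 2 4 (by decide)
        (fun u => by simp [coadMap_g10, h0, h0']) (fun u => by simp [coadMap_g10, h0']) h
  · rintro (⟨h0, h1, h2⟩ | ⟨h0, h1⟩)
    · exact finrank_range_coadMap_eq (coadOnto_g10_of_eq_zero_left lam h0 h1 h2)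
    · by_cases h2 : x 4 = 0
      · have h3 : x 2 ≠ 0 := by tauto
        exact finrank_range_coadMap_eq (coadOnto_g10_of_eq_zero_right lam h2 h3 h0)
      · exact finrank_range_coadMap_eq (coadOnto_g10 lam h0 h2)

end OrbitDimension

/-! ### The orbits of each family -/

section OrbitDescription

variable {G : Type*} [TopologicalSpace G] [ChartedSpace R7 G] [Group G]
  [LieGroup 𝓘(ℝ, R7) ∞ G] [ConnectedSpace G]

theorem coadjointOrbit_g2_of_eq_zero (e : SolvLie .g2 ≃ₗ⁅ℝ⁆ GroupLieAlgebra 𝓘(ℝ, R7) G)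
    {F : Module.Dual ℝ (GroupLieAlgebra 𝓘(ℝ, R7) G)} (h4 : dualCoords e F 4 = 0)
    (h2 : dualCoords e F 2 ≠ 0) (h3 : dualCoords e F 3 ≠ 0) :
    coadjointOrbit F = dualCoords e ⁻¹'
      {x | x 4 = 0 ∧ 0 < dualCoords e F 2 * x 2 ∧ 0 < dualCoords e F 3 * x 3} :=
  coadjointOrbit_eq_of_vanishing e 4 2 3 (by decide) (by decide) (p := fun u => u 5 + u 6)
    (q := fun u => u 6) (r := fun u => u 5) (by fun_prop) (by fun_prop) (by fun_prop)
    (fun x u => by simp [coadMap_g2]) (fun x u h => by simp [coadMap_g2, h])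
    (fun x u h => by simp [coadMap_g2]) (fun x => coadOnto_g2_of_eq_zero) h4 h2 h3

theorem coadjointOrbit_g4_of_eq_zero (e : SolvLie .g4 ≃ₗ⁅ℝ⁆ GroupLieAlgebra 𝓘(ℝ, R7) G)
    {F : Module.Dual ℝ (GroupLieAlgebra 𝓘(ℝ, R7) G)} (h3 : dualCoords e F 3 = 0)
    (h1 : dualCoords e F 1 ≠ 0) (h4 : dualCoords e F 4 ≠ 0) :
    coadjointOrbit F = dualCoords e ⁻¹'
      {x | x 3 = 0 ∧ 0 < dualCoords e F 1 * x 1 ∧ 0 < dualCoords e F 4 * x 4} :=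
  coadjointOrbit_eq_of_vanishing e 3 1 4 (by decide) (by decide) (p := fun u => u 5 + u 6)
    (q := fun u => u 6) (r := fun u => u 5) (by fun_prop) (by fun_prop) (by fun_prop)
    (fun x u => by simp [coadMap_g4]) (fun x u h => by simp [coadMap_g4, h])
    (fun x u h => by simp [coadMap_g4]) (fun x => coadOnto_g4_of_eq_zero) h3 h1 h4

theorem coadjointOrbit_g3_of_eq_zero_left (e : SolvLie .g3 ≃ₗ⁅ℝ⁆ GroupLieAlgebra 𝓘(ℝ, R7) G)
    {F : Module.Dual ℝ (GroupLieAlgebra 𝓘(ℝ, R7) G)} (h3 : dualCoords e F 3 = 0)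
    (h1 : dualCoords e F 1 ≠ 0) (h4 : dualCoords e F 4 ≠ 0) :
    coadjointOrbit F = dualCoords e ⁻¹'
      {x | x 3 = 0 ∧ 0 < dualCoords e F 1 * x 1 ∧ 0 < dualCoords e F 4 * x 4} :=
  coadjointOrbit_eq_of_vanishing e 3 1 4 (by decide) (by decide) (p := fun u => u 5)
    (q := fun u => u 5) (r := fun u => u 6) (by fun_prop) (by fun_prop) (by fun_prop)
    (fun x u => by simp [coadMap_g3]) (fun x u h => by simp [coadMap_g3, h])
    (fun x u h => by simp [coadMap_g3]) (fun x => coadOnto_g3_of_eq_zero_left) h3 h1 h4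

theorem coadjointOrbit_g3_of_eq_zero_right (e : SolvLie .g3 ≃ₗ⁅ℝ⁆ GroupLieAlgebra 𝓘(ℝ, R7) G)
    {F : Module.Dual ℝ (GroupLieAlgebra 𝓘(ℝ, R7) G)} (h4 : dualCoords e F 4 = 0)
    (h2 : dualCoords e F 2 ≠ 0) (h3 : dualCoords e F 3 ≠ 0) :
    coadjointOrbit F = dualCoords e ⁻¹'
      {x | x 4 = 0 ∧ 0 < dualCoords e F 2 * x 2 ∧ 0 < dualCoords e F 3 * x 3} :=
  coadjointOrbit_eq_of_vanishing e 4 2 3 (by decide) (by decide) (p := fun u => u 6)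
    (q := fun u => u 6) (r := fun u => u 5) (by fun_prop) (by fun_prop) (by fun_prop)
    (fun x u => by simp [coadMap_g3]) (fun x u h => by simp [coadMap_g3, h])
    (fun x u h => by simp [coadMap_g3]) (fun x => coadOnto_g3_of_eq_zero_right) h4 h2 h3

theorem coadjointOrbit_g9_of_eq_zero_left (e : SolvLie .g9 ≃ₗ⁅ℝ⁆ GroupLieAlgebra 𝓘(ℝ, R7) G)
    {F : Module.Dual ℝ (GroupLieAlgebra 𝓘(ℝ, R7) G)} (h3 : dualCoords e F 3 = 0)
    (h1 : dualCoords e F 1 ≠ 0) (h4 : dualCoords e F 4 ≠ 0) :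
    coadjointOrbit F = dualCoords e ⁻¹'
      {x | x 3 = 0 ∧ 0 < dualCoords e F 1 * x 1 ∧ 0 < dualCoords e F 4 * x 4} :=
  coadjointOrbit_eq_of_vanishing e 3 1 4 (by decide) (by decide) (p := fun u => u 6)
    (q := fun u => u 6) (r := fun u => u 5) (by fun_prop) (by fun_prop) (by fun_prop)
    (fun x u => by simp [coadMap_g9]) (fun x u h => by simp [coadMap_g9, h])
    (fun x u h => by simp [coadMap_g9]) (fun x => coadOnto_g9_of_eq_zero_left) h3 h1 h4

theorem coadjointOrbit_g9_of_eq_zero_right (e : SolvLie .g9 ≃ₗ⁅ℝ⁆ GroupLieAlgebra 𝓘(ℝ, R7) G)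
    {F : Module.Dual ℝ (GroupLieAlgebra 𝓘(ℝ, R7) G)} (h4 : dualCoords e F 4 = 0)
    (h2 : dualCoords e F 2 ≠ 0) (h3 : dualCoords e F 3 ≠ 0) :
    coadjointOrbit F = dualCoords e ⁻¹'
      {x | x 4 = 0 ∧ 0 < dualCoords e F 2 * x 2 ∧ 0 < dualCoords e F 3 * x 3} :=
  coadjointOrbit_eq_of_vanishing e 4 2 3 (by decide) (by decide) (p := fun u => u 5)
    (q := fun u => u 5) (r := fun u => u 6) (by fun_prop) (by fun_prop) (by fun_prop)
    (fun x u => by simp [coadMap_g9]) (fun x u h => by simp [coadMap_g9, h])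
    (fun x u h => by simp [coadMap_g9]) (fun x => coadOnto_g9_of_eq_zero_right) h4 h2 h3

theorem coadjointOrbit_g10_of_eq_zero_left {lam : ℝ}
    (e : SolvLie (.g10 lam) ≃ₗ⁅ℝ⁆ GroupLieAlgebra 𝓘(ℝ, R7) G)
    {F : Module.Dual ℝ (GroupLieAlgebra 𝓘(ℝ, R7) G)} (h3 : dualCoords e F 3 = 0)
    (h1 : dualCoords e F 1 ≠ 0) (h4 : dualCoords e F 4 ≠ 0) :
    coadjointOrbit F = dualCoords e ⁻¹'
      {x | x 3 = 0 ∧ 0 < dualCoords e F 1 * x 1 ∧ 0 < dualCoords e F 4 * x 4} :=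
  coadjointOrbit_eq_of_vanishing e 3 1 4 (by decide) (by decide) (p := fun u => u 5)
    (q := fun u => u 5) (r := fun u => lam * u 5 + u 6) (by fun_prop) (by fun_prop) (by fun_prop)
    (fun x u => by simp [coadMap_g10]) (fun x u h => by simp [coadMap_g10, h])
    (fun x u h => by simp [coadMap_g10]) (fun x => coadOnto_g10_of_eq_zero_left lam) h3 h1 h4

theorem coadjointOrbit_g10_of_eq_zero_right {lam : ℝ}
    (e : SolvLie (.g10 lam) ≃ₗ⁅ℝ⁆ GroupLieAlgebra 𝓘(ℝ, R7) G)
    {F : Module.Dual ℝ (GroupLieAlgebra 𝓘(ℝ, R7) G)} (h4 : dualCoords e F 4 = 0)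
    (h2 : dualCoords e F 2 ≠ 0) (h3 : dualCoords e F 3 ≠ 0) :
    coadjointOrbit F = dualCoords e ⁻¹'
      {x | x 4 = 0 ∧ 0 < dualCoords e F 2 * x 2 ∧ 0 < dualCoords e F 3 * x 3} :=
  coadjointOrbit_eq_of_vanishing e 4 2 3 (by decide) (by decide) (p := fun u => lam * u 5 + u 6)
    (q := fun u => lam * u 5 + u 6) (r := fun u => u 5) (by fun_prop) (by fun_prop) (by fun_prop)
    (fun x u => by simp [coadMap_g10]) (fun x u h => by simp [coadMap_g10, h, add_mul])
    (fun x u h => by simp [coadMap_g10]) (fun x => coadOnto_g10_of_eq_zero_right lam) h4 h2 h3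

theorem coadjointOrbit_g2 (e : SolvLie .g2 ≃ₗ⁅ℝ⁆ GroupLieAlgebra 𝓘(ℝ, R7) G)
    {F : Module.Dual ℝ (GroupLieAlgebra 𝓘(ℝ, R7) G)} {a : Fin 7 → ℝ} (ha : a = dualCoords e F)
    (h₃ : a 3 ≠ 0) (h₄ : a 4 ≠ 0) :
    coadjointOrbit F = dualCoords e ⁻¹'
      {x | x 1 - x 2 * x 3 / x 4 = (a 1 * a 4 - a 2 * a 3) / a 4 ∧
        0 < a 3 * x 3 ∧ 0 < a 4 * x 4} := by
  subst ha
  refine coadjointOrbit_eq_levelSet e 1 3 4 (by decide) (by decide)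
    (q := fun u => u 5) (r := fun u => u 5 + u 6) (by fun_prop) (by fun_prop)
    (fun x u => by simp [coadMap_g2]) (fun x u => by simp [coadMap_g2])
    (I := fun x => x 1 - x 2 * x 3 / x 4)
    (f := fun x =>
      (dualCoords e F 1 * dualCoords e F 4 - dualCoords e F 2 * dualCoords e F 3) /
        dualCoords e F 4 + x 2 * x 3 / x 4)
    (fun x y h => by simp only [h 2 (by decide), h 3 (by decide), h 4 (by decide)])
    (fun x h₃ h₄ => sub_eq_iff_eq_add) (fun u x t h₃ h₄ hx => ?_)
    (fun x => coadOnto_g2) (by field_simp) h₃ h₄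
  -- Both `x 1` and `x 2 * x 3 / x 4` have derivative `u 0 * x 3`, as the contributions of `u 5` and
  -- `u 6` to the quotient cancel.
  refine HasDerivAt.congr_deriv ((hx 1).sub (((hx 2).mul (hx 3)).div (hx 4) h₄)) ?_
  simp [coadMap_g2]
  field_simp
  ring

theorem coadjointOrbit_g4 (e : SolvLie .g4 ≃ₗ⁅ℝ⁆ GroupLieAlgebra 𝓘(ℝ, R7) G)
    {F : Module.Dual ℝ (GroupLieAlgebra 𝓘(ℝ, R7) G)} {a : Fin 7 → ℝ} (ha : a = dualCoords e F)
    (h₃ : a 3 ≠ 0) (h₄ : a 4 ≠ 0) :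
    coadjointOrbit F = dualCoords e ⁻¹'
      {x | x 2 - x 1 * x 4 / x 3 = (a 2 * a 3 - a 1 * a 4) / a 3 ∧
        0 < a 3 * x 3 ∧ 0 < a 4 * x 4} := by
  subst ha
  refine coadjointOrbit_eq_levelSet e 2 3 4 (by decide) (by decide)
    (q := fun u => u 5 + u 6) (r := fun u => u 5) (by fun_prop) (by fun_prop)
    (fun x u => by simp [coadMap_g4]) (fun x u => by simp [coadMap_g4])
    (I := fun x => x 2 - x 1 * x 4 / x 3)
    (f := fun x =>
      (dualCoords e F 2 * dualCoords e F 3 - dualCoords e F 1 * dualCoords e F 4) /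
        dualCoords e F 3 + x 1 * x 4 / x 3)
    (fun x y h => by simp only [h 1 (by decide), h 3 (by decide), h 4 (by decide)])
    (fun x h₃ h₄ => sub_eq_iff_eq_add) (fun u x t h₃ h₄ hx => ?_)
    (fun x => coadOnto_g4) (by field_simp) h₃ h₄
  refine HasDerivAt.congr_deriv ((hx 2).sub (((hx 1).mul (hx 4)).div (hx 3) h₃)) ?_
  simp [coadMap_g4]
  field_simp
  ring

theorem coadjointOrbit_g3 (e : SolvLie .g3 ≃ₗ⁅ℝ⁆ GroupLieAlgebra 𝓘(ℝ, R7) G)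
    {F : Module.Dual ℝ (GroupLieAlgebra 𝓘(ℝ, R7) G)} {a : Fin 7 → ℝ} (ha : a = dualCoords e F)
    (h₃ : a 3 ≠ 0) (h₄ : a 4 ≠ 0) :
    coadjointOrbit F = dualCoords e ⁻¹'
      {x | x 1 / x 3 - x 2 / x 4 = a 1 / a 3 - a 2 / a 4 ∧ 0 < a 3 * x 3 ∧ 0 < a 4 * x 4} := by
  subst ha
  refine coadjointOrbit_eq_levelSet e 1 3 4 (by decide) (by decide)
    (q := fun u => u 5) (r := fun u => u 6) (by fun_prop) (by fun_prop)
    (fun x u => by simp [coadMap_g3]) (fun x u => by simp [coadMap_g3])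
    (I := fun x => x 1 / x 3 - x 2 / x 4)
    (f := fun x =>
      (dualCoords e F 1 / dualCoords e F 3 - dualCoords e F 2 / dualCoords e F 4 + x 2 / x 4) * x 3)
    (fun x y h => by simp only [h 2 (by decide), h 3 (by decide), h 4 (by decide)])
    (fun x h₃ h₄ => by
      rw [sub_eq_iff_eq_add, div_eq_iff h₃]) (fun u x t h₃ h₄ hx => ?_)
    (fun x => coadOnto_g3) rfl h₃ h₄
  -- Both quotients have derivative `u 0`.
  refine HasDerivAt.congr_deriv (((hx 1).div (hx 3) h₃).sub ((hx 2).div (hx 4) h₄)) ?_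
  simp [coadMap_g3]
  field_simp
  ring

theorem coadjointOrbit_g9 (e : SolvLie .g9 ≃ₗ⁅ℝ⁆ GroupLieAlgebra 𝓘(ℝ, R7) G)
    {F : Module.Dual ℝ (GroupLieAlgebra 𝓘(ℝ, R7) G)} {a : Fin 7 → ℝ} (ha : a = dualCoords e F)
    (h₃ : a 3 ≠ 0) (h₄ : a 4 ≠ 0) :
    coadjointOrbit F = dualCoords e ⁻¹'
      {x | x 1 / x 3 - x 2 / x 4 + Real.log |x 3|
        = a 1 / a 3 - a 2 / a 4 + Real.log |a 3| ∧
        0 < a 3 * x 3 ∧ 0 < a 4 * x 4} := by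
  subst ha
  refine coadjointOrbit_eq_levelSet e 1 3 4 (by decide) (by decide)
    (q := fun u => u 6) (r := fun u => u 5) (by fun_prop) (by fun_prop)
    (fun x u => by simp [coadMap_g9]) (fun x u => by simp [coadMap_g9])
    (I := fun x => x 1 / x 3 - x 2 / x 4 + Real.log |x 3|)
    (f := fun x =>
      (dualCoords e F 1 / dualCoords e F 3 - dualCoords e F 2 / dualCoords e F 4 +
        Real.log |dualCoords e F 3| - Real.log |x 3| + x 2 / x 4) * x 3)
    (fun x y h => by simp only [h 2 (by decide), h 3 (by decide), h 4 (by decide)])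
    (fun x h₃ h₄ => by
      rw [← eq_sub_iff_add_eq, sub_eq_iff_eq_add, div_eq_iff h₃]) (fun u x t h₃ h₄ hx => ?_)
    (fun x => coadOnto_g9) rfl h₃ h₄
  simp only [Real.log_abs]
  -- The nilpotent part of `ad Y` makes the difference of quotients drift at rate `-u 6`; the
  -- logarithm of `x 3` has derivative `u 6` and compensates.
  refine HasDerivAt.congr_deriv ((((hx 1).div (hx 3) h₃).sub ((hx 2).div (hx 4) h₄)).add
    ((hx 3).log h₃)) ?_
  simp [coadMap_g9]
  field_simp
  ring

theorem log_abs_div_abs_rpow {s t lam : ℝ} (hs : s ≠ 0) (ht : t ≠ 0) :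
    Real.log (|t| / |s| ^ lam) = Real.log t - lam * Real.log s := by
  have hs' := abs_pos.2 hs
  rw [Real.log_div (abs_ne_zero.2 ht) (Real.rpow_pos_of_pos hs' _).ne', Real.log_rpow hs',
    Real.log_abs, Real.log_abs]

theorem coadjointOrbit_g10 {lam : ℝ}
    (e : SolvLie (.g10 lam) ≃ₗ⁅ℝ⁆ GroupLieAlgebra 𝓘(ℝ, R7) G)
    {F : Module.Dual ℝ (GroupLieAlgebra 𝓘(ℝ, R7) G)} {a : Fin 7 → ℝ} (ha : a = dualCoords e F)
    (h₃ : a 3 ≠ 0) (h₄ : a 4 ≠ 0) :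
    coadjointOrbit F = dualCoords e ⁻¹'
      {x | x 1 / x 3 - x 2 / x 4 + Real.log (|x 4| / |x 3| ^ lam)
        = a 1 / a 3 - a 2 / a 4 + Real.log (|a 4| / |a 3| ^ lam) ∧
        0 < a 3 * x 3 ∧ 0 < a 4 * x 4} := by
  subst ha
  refine coadjointOrbit_eq_levelSet e 1 3 4 (by decide) (by decide)
    (q := fun u => u 5) (r := fun u => lam * u 5 + u 6) (by fun_prop) (by fun_prop)
    (fun x u => by simp [coadMap_g10]) (fun x u => by simp [coadMap_g10])
    (I := fun x => x 1 / x 3 - x 2 / x 4 + Real.log (|x 4| / |x 3| ^ lam))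
    (f := fun x =>
      (dualCoords e F 1 / dualCoords e F 3 - dualCoords e F 2 / dualCoords e F 4 +
        Real.log (|dualCoords e F 4| / |dualCoords e F 3| ^ lam)
      - Real.log (|x 4| / |x 3| ^ lam) + x 2 / x 4) * x 3)
    (fun x y h => by simp only [h 2 (by decide), h 3 (by decide), h 4 (by decide)])
    (fun x h₃ h₄ => by
      rw [← eq_sub_iff_add_eq, sub_eq_iff_eq_add, div_eq_iff h₃]) (fun u x t h₃ h₄ hx => ?_)
    (fun x => coadOnto_g10 lam) rfl h₃ h₄
  -- The expansion of the logarithm needs both coordinates nonzero, so it is only available near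
  -- `t`. There `log x₄ - lam log x₃`, in these indices, has derivative `u 6`, against the drift `-u
  -- 6` of the quotients.
  have hlog : (fun s => x s 1 / x s 3 - x s 2 / x s 4 + (Real.log (x s 4) - lam * Real.log (x s 3)))
      =ᶠ[nhds t] fun s => x s 1 / x s 3 - x s 2 / x s 4 + Real.log (|x s 4| / |x s 3| ^ lam) := by
    filter_upwards [(hx 3).continuousAt.eventually_ne h₃, (hx 4).continuousAt.eventually_ne h₄]
      with s h₃ h₄
    rw [log_abs_div_abs_rpow h₃ h₄]
  refine HasDerivAt.congr_of_eventuallyEq ?_ hlog.symm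
  refine HasDerivAt.congr_deriv ((((hx 1).div (hx 3) h₃).sub ((hx 2).div (hx 4) h₄)).add
    (((hx 4).log h₄).sub (((hx 3).log h₃).const_mul lam))) ?_
  simp [coadMap_g10]
  field_simp
  ring

end OrbitDescription

/-! ### Irreducible quadrics -/

section Quadric

open MvPolynomial

/-- The polynomial has degree one in `X j` with prime leading coefficient `X i`. A proper
factorisation would force `X i` to divide the remainder, hence `X k * X l`. -/
theorem irreducible_quadric {i j k l : Fin 7} (hij : i ≠ j) (hik : i ≠ k) (hil : i ≠ l)
    (hjk : j ≠ k) (hjl : j ≠ l) (c d : ℝ) :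
    Irreducible (X i * X j + (X i * (C c + C d * X k) - X k * X l) : MvPolynomial (Fin 7) ℝ) := by
  have hvars : ∀ p q : MvPolynomial (Fin 7) ℝ, j ∉ p.vars → j ∉ q.vars → j ∉ (p * q).vars :=
    fun p q hp hq h => (Finset.mem_union.1 (vars_mul p q h)).elim hp hq
  have hX : ∀ m : Fin 7, j ≠ m → j ∉ (X m : MvPolynomial (Fin 7) ℝ).vars := fun m hm => by
    simpa [vars_X] using hm
  refine irreducible_mul_X_add _ _ j (X_ne_zero i) (hX i hij.symm) ?_ ?_
  · rw [sub_eq_add_neg]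
    refine fun h => (Finset.mem_union.1 (vars_add_subset _ _ h)).elim ?_ ?_
    · refine hvars _ _ (hX i hij.symm) fun h => (Finset.mem_union.1 (vars_add_subset _ _ h)).elim
        (by simp) (hvars _ _ (by simp) (hX k hjk))
    · rw [vars_neg]
      exact hvars _ _ (hX k hjk) (hX l hjl)
  · have hp : Irreducible (X i : MvPolynomial (Fin 7) ℝ) :=
      irreducible_of_totalDegree_eq_one (totalDegree_X i) fun r hr => by
        have h := hr (Finsupp.single i 1)
        rw [coeff_X, if_pos rfl] at h
        exact isUnit_of_dvd_one h
    rw [hp.isRelPrime_iff_not_dvd]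
    intro h
    rw [dvd_sub_right (dvd_mul_right _ _), X, X, X, monomial_mul, ← X, X_dvd_monomial] at h
    simp [hik.symm, hil.symm] at h

theorem totalDegree_quadric {i j k l : Fin 7} (hij : i ≠ j)
    (hjk : j ≠ k) (hjl : j ≠ l) (c d : ℝ) :
    (X i * X j + (X i * (C c + C d * X k) - X k * X l) : MvPolynomial (Fin 7) ℝ).totalDegree =
      2 := by
  have hX : ∀ m : Fin 7, (X m : MvPolynomial (Fin 7) ℝ).totalDegree ≤ 1 := fun m =>
    (totalDegree_X m).le
  have hmul : ∀ p q : MvPolynomial (Fin 7) ℝ, p.totalDegree ≤ 1 → q.totalDegree ≤ 1 →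
      (p * q).totalDegree ≤ 2 := fun p q hp hq =>
    (totalDegree_mul p q).trans (by omega)
  refine le_antisymm ?_ ?_
  · refine (totalDegree_add _ _).trans (max_le (hmul _ _ (hX i) (hX j)) ?_)
    refine (totalDegree_sub _ _).trans (max_le (hmul _ _ (hX i) ?_) (hmul _ _ (hX k) (hX l)))
    refine (totalDegree_add _ _).trans (max_le (by simp) ?_)
    exact (totalDegree_mul _ _).trans (by simp)
  · have hc : coeff (Finsupp.single i 1 + Finsupp.single j 1)
        (X i * X j + (X i * (C c + C d * X k) - X k * X l) : MvPolynomial (Fin 7) ℝ) = 1 := by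
      have h1 : Finsupp.single k 1 + Finsupp.single l 1 ≠
          (Finsupp.single i 1 + Finsupp.single j 1 : Fin 7 →₀ ℕ) := fun h => by
        simpa [Finsupp.single_apply, hij, hjk.symm, hjl.symm] using DFunLike.congr_fun h j
      have h2 : Finsupp.single i 1 + Finsupp.single k 1 ≠
          (Finsupp.single i 1 + Finsupp.single j 1 : Fin 7 →₀ ℕ) := fun h => by
        simpa [Finsupp.single_apply, hij, hjk.symm, hjl.symm] using DFunLike.congr_fun h j
      have h3 : Finsupp.single i 1 ≠
          (Finsupp.single i 1 + Finsupp.single j 1 : Fin 7 →₀ ℕ) := fun h => by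
        simpa [Finsupp.single_apply, hij, hjk.symm, hjl.symm] using DFunLike.congr_fun h j
      simp only [X, mul_add, C_mul_monomial, monomial_mul, coeff_add, coeff_sub]
      rw [mul_comm (monomial _ _) (C c), C_mul_monomial]
      simp only [coeff_monomial, if_neg h1, if_neg h2, if_neg h3]
      simp
    have hs : (Finsupp.single i 1 + Finsupp.single j 1) ∈
        (X i * X j + (X i * (C c + C d * X k) - X k * X l) : MvPolynomial (Fin 7) ℝ).support := by
      rw [mem_support_iff, hc]
      exact one_ne_zero
    have := le_totalDegree hs
    rw [Finsupp.sum_add_index' (by simp) (by simp)] at this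
    simpa using this

theorem isPartOfQuadric_of_forall {i j k l : Fin 7} (hij : i ≠ j) (hik : i ≠ k) (hil : i ≠ l)
    (hjk : j ≠ k) (hjl : j ≠ l) (c d : ℝ) {S : Set (Fin 7 → ℝ)}
    (h : ∀ x ∈ S, x i * x j + (x i * (c + d * x k) - x k * x l) = 0) : IsPartOfQuadric S :=
  ⟨_, irreducible_quadric hij hik hil hjk hjl c d, totalDegree_quadric hij hjk hjl c d,
    fun x hx => by simpa using h x hx⟩

end Quadric

/-! ### Algebraic independence of `s` and `exp s` -/

section Transcendental

open Filter Topology Polynomial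

theorem tendsto_evalEval_exp (q : ℝ[X][X]) :
    Tendsto (fun t : ℝ => q.evalEval (-t) (Real.exp (-t)) / Real.exp t) atTop (𝓝 0) := by
  induction q using Polynomial.induction_on' with
  | add p q hp hq => simpa [add_div] using hp.add hq
  | monomial k a =>
    have h1 := (a.comp (-X)).tendsto_div_exp_atTop
    have h2 := (Real.tendsto_exp_neg_atTop_nhds_zero).pow k
    have h3 := h1.mul h2
    rw [zero_mul] at h3
    refine h3.congr fun t => ?_
    simp [evalEval, eval_monomial]
    ring

/-- At `s = -t` the relation equates the constant coefficient, up to sign, with `exp (-t)` times a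
polynomial in `-t` and `exp (-t)`. This tends to zero as `t → ∞`, and a polynomial with limit zero
at infinity is zero. -/
theorem coeff_zero_eq_zero_of_evalEval_exp {q : ℝ[X][X]}
    (h : ∀ s : ℝ, q.evalEval s (Real.exp s) = 0) : q.coeff 0 = 0 := by
  have h1 : ∀ t : ℝ, (-(q.coeff 0).comp (-X)).eval t =
      q.divX.evalEval (-t) (Real.exp (-t)) / Real.exp t := by
    intro t
    have h2 := h (-t)
    rw [← divX_mul_X_add q] at h2
    simp only [evalEval_add, evalEval_mul, evalEval_X, evalEval_C] at h2
    rw [div_eq_mul_inv, ← Real.exp_neg]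
    simp
    linarith
  have h2 := (tendsto_evalEval_exp q.divX).congr fun t => (h1 t).symm
  have h3 := ((tendsto_nhds_iff _).1 h2).1
  rw [leadingCoeff_eq_zero, neg_eq_zero] at h3
  have h4 := congrArg (fun p : ℝ[X] => p.comp (-X)) h3
  simpa [comp_assoc] using h4

theorem eq_zero_of_evalEval_exp {q : ℝ[X][X]}
    (h : ∀ s : ℝ, q.evalEval s (Real.exp s) = 0) : q = 0 := by
  ext1 n
  rw [coeff_zero]
  -- Once the constant coefficient vanishes, the nonzero factor `exp s` can be cancelled and
  -- `q.divX` satisfies the same relation.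
  induction n generalizing q with
  | zero => exact coeff_zero_eq_zero_of_evalEval_exp h
  | succ n ih =>
    rw [← coeff_divX]
    refine ih fun s => ?_
    have h2 := h s
    rw [← divX_mul_X_add q, coeff_zero_eq_zero_of_evalEval_exp h] at h2
    simpa [Real.exp_ne_zero] using h2

theorem eval_eq_zero_of_exp_curve (p : MvPolynomial (Fin 7) ℝ) {i j : Fin 7}
    (x : Fin 7 → ℝ) (ε c τ : ℝ)
    (h : ∀ s : ℝ, MvPolynomial.eval (Function.update (Function.update x j (ε * Real.exp s)) i
      (ε * Real.exp s * (c + τ * s))) p = 0) (s y : ℝ) :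
    MvPolynomial.eval (Function.update (Function.update x j (ε * y)) i
      (ε * y * (c + τ * s))) p = 0 := by
  -- The inner variable stands for `s` and the outer one for `exp s`; a polynomial vanishing on the
  -- curve then vanishes for independent values `s` and `y`.
  let g : Fin 7 → ℝ[X][X] := Function.update (Function.update (fun k => C (C (x k))) j
    (C (C ε) * X)) i (C (C ε) * X * C (C c + C τ * X))
  have key : ∀ s y : ℝ, (MvPolynomial.aeval g p).evalEval s y =
      MvPolynomial.eval (Function.update (Function.update x j (ε * y)) i
        (ε * y * (c + τ * s))) p := by
    intro s y
    have h1 := MvPolynomial.map_aeval g (evalEvalRingHom s y) p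
    have h2 : (evalEvalRingHom s y).comp (algebraMap ℝ ℝ[X][X]) = RingHom.id ℝ := by
      ext r
      simp
    have h3 : (fun k => evalEvalRingHom s y (g k)) =
        Function.update (Function.update x j (ε * y)) i (ε * y * (c + τ * s)) := by
      ext k
      by_cases hi : k = i
      · subst hi; simp [g]
      · by_cases hj : k = j
        · subst hj; simp [g, Function.update_of_ne hi]
        · simp [g, Function.update_of_ne hi, Function.update_of_ne hj]
    rw [h2, h3] at h1
    exact h1
  have h0 : MvPolynomial.aeval g p = 0 := eq_zero_of_evalEval_exp fun s => by rw [key, h]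
  rw [← key, h0]
  simp

/-- No nonzero polynomial vanishes on a graph over a half-space which contains curves
`(ε exp s, ε exp s (c + τ s))` with fixed remaining coordinates. -/
theorem isTranscendentalSet_of_exp_curves {S : Set (Fin 7 → ℝ)} {i j k : Fin 7}
    (a : ℝ) (ha : a ≠ 0) {ε τ : ℝ} (hε : ε ≠ 0) (hτ : τ ≠ 0)
    (h : ∀ x : Fin 7 → ℝ, 0 < a * x k → ∃ c : ℝ, ∀ s : ℝ,
      Function.update (Function.update x j (ε * Real.exp s)) i
        (ε * Real.exp s * (c + τ * s)) ∈ S) : IsTranscendentalSet S := by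
  intro p hp
  -- It suffices that `p` vanishes on a product of infinite sets, here given by `0 < a * x k` and `x
  -- j ≠ 0`.
  refine MvPolynomial.funext_set (fun m => {r : ℝ | (m = k → 0 < a * r) ∧ (m = j → r ≠ 0)}) ?_ ?_
  · intro m
    have hinf : ((fun r : ℝ => a * r) '' Set.Ioi 0).Infinite :=
      (Set.Ioi_infinite 0).image (fun r _ s _ hrs => mul_left_cancel₀ ha hrs)
    refine hinf.mono ?_
    rintro _ ⟨r, hr, rfl⟩
    have hr' : 0 < r := hr
    refine ⟨fun _ => ?_, fun _ => mul_ne_zero ha hr'.ne'⟩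
    rw [← mul_assoc]
    exact mul_pos (mul_self_pos.2 ha) hr'
  · intro x hx
    rw [map_zero]
    have hxk : 0 < a * x k := (hx k trivial).1 rfl
    have hxj : x j ≠ 0 := (hx j trivial).2 rfl
    obtain ⟨c, hc⟩ := h x hxk
    -- The parameters solve `ε y = x j` and `c + τ s = x i / x j`, so that the point reached is `x`
    -- itself.
    have h1 := eval_eq_zero_of_exp_curve p x ε c τ (fun s => hp _ (hc s))
      ((x i / x j - c) / τ) (x j / ε)
    have h2 : Function.update (Function.update x j (ε * (x j / ε))) i
        (ε * (x j / ε) * (c + τ * ((x i / x j - c) / τ))) = x := by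
      have e1 : ε * (x j / ε) = x j := by field_simp
      have e2 : x j * (c + τ * ((x i / x j - c) / τ)) = x i := by field_simp; ring
      rw [e1, e2, Function.update_eq_self, Function.update_eq_self]
    rwa [h2] at h1

end Transcendental

/-! ### Assembly -/

section MainTheorem

theorem image_dualCoords_preimage {G : Type*} [TopologicalSpace G] [ChartedSpace R7 G] [Group G]
    [LieGroup 𝓘(ℝ, R7) ∞ G] {K : SolvKind} (e : SolvLie K ≃ₗ⁅ℝ⁆ GroupLieAlgebra 𝓘(ℝ, R7) G)
    (S : Set (Fin 7 → ℝ)) : dualCoords e '' (dualCoords e ⁻¹' S) = S :=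
  Set.image_preimage_eq S (dualCoords_surjective e)

theorem isTranscendentalSet_g9 (c : ℝ) {a : Fin 7 → ℝ} (h₃ : a 3 ≠ 0) (h₄ : a 4 ≠ 0) :
    IsTranscendentalSet {x : Fin 7 → ℝ | x 1 / x 3 - x 2 / x 4 + Real.log |x 3| = c ∧
      0 < a 3 * x 3 ∧ 0 < a 4 * x 4} := by
  refine isTranscendentalSet_of_exp_curves (i := 1) (j := 3) (k := 4) (a 4) h₄ h₃
    (τ := -1) (by norm_num) fun x hx => ⟨c + x 2 / x 4 - Real.log (a 3), fun s => ?_⟩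
  have hs := Real.exp_ne_zero s
  refine ⟨?_, ?_, ?_⟩
  · have h : Real.log |a 3 * Real.exp s| = Real.log (a 3) + s := by
      rw [Real.log_abs, Real.log_mul h₃ hs, Real.log_exp]
    simp only [Function.update, Fin.isValue, Fin.reduceEq, dite_false, dite_true, eq_rec_constant]
    rw [h]
    field_simp
    ring
  · simpa [Function.update, ← mul_assoc] using
      mul_pos (mul_self_pos.2 h₃) (Real.exp_pos s)
  · simpa [Function.update] using hx

theorem isTranscendentalSet_g10 (lam c : ℝ) {a : Fin 7 → ℝ} (h₃ : a 3 ≠ 0) (h₄ : a 4 ≠ 0) :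
    IsTranscendentalSet {x : Fin 7 → ℝ |
      x 1 / x 3 - x 2 / x 4 + Real.log (|x 4| / |x 3| ^ lam) = c ∧
      0 < a 3 * x 3 ∧ 0 < a 4 * x 4} := by
  -- The curve runs along `x 4`, where the slope in `s` is `1`; along `x 3` it would be `lam`, which
  -- may vanish.
  refine isTranscendentalSet_of_exp_curves (i := 2) (j := 4) (k := 3) (a 3) h₃ h₄
    (τ := 1) (by norm_num) fun x hx =>
      ⟨x 1 / x 3 + Real.log (a 4) - lam * Real.log (x 3) - c, fun s => ?_⟩
  have hs := Real.exp_ne_zero s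
  have hx3 : x 3 ≠ 0 := right_ne_zero_of_mul hx.ne'
  refine ⟨?_, ?_, ?_⟩
  · have h := log_abs_div_abs_rpow (lam := lam) hx3 (mul_ne_zero h₄ hs)
    rw [Real.log_mul h₄ hs, Real.log_exp] at h
    simp only [Function.update, Fin.isValue, Fin.reduceEq, dite_false, dite_true, eq_rec_constant]
    rw [h]
    field_simp
    ring
  · simpa [Function.update] using hx
  · simpa [Function.update, ← mul_assoc] using
      mul_pos (mul_self_pos.2 h₄) (Real.exp_pos s)

end MainTheorem

theorem theorem3p3 (K : SolvKind) {G : Type*} [TopologicalSpace G] [ChartedSpace R7 G] [Group G]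
    [LieGroup 𝓘(ℝ, R7) ∞ G] [SimplyConnectedSpace G]
    (e : SolvLie K ≃ₗ⁅ℝ⁆ GroupLieAlgebra 𝓘(ℝ, R7) G) :
    -- the maximal dimension of the coadjoint orbits is exactly six
    IsGreatest (Set.range (orbitDim e)) 6 ∧
    -- the picture for `G₂`
    (K = .g2 → ∀ (F : Module.Dual ℝ (GroupLieAlgebra 𝓘(ℝ, R7) G)) (a : Fin 7 → ℝ),
      a = dualCoords e F →
      (orbitDim e F = 6 ↔ a 3 ≠ 0 ∧ a 2 ^ 2 + a 4 ^ 2 ≠ 0) ∧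
      (a 2 * a 3 ≠ 0 → a 4 = 0 →
        coadjointOrbit F = dualCoords e ⁻¹'
          {x | x 4 = 0 ∧ 0 < a 2 * x 2 ∧ 0 < a 3 * x 3}) ∧
      (a 3 * a 4 ≠ 0 →
        coadjointOrbit F = dualCoords e ⁻¹'
          {x | x 1 - x 2 * x 3 / x 4 = (a 1 * a 4 - a 2 * a 3) / a 4 ∧
            0 < a 3 * x 3 ∧ 0 < a 4 * x 4} ∧
        IsPartOfQuadric (dualCoords e '' coadjointOrbit F))) ∧
    -- the picture for `G₄⁰⁰`
    (K = .g4 → ∀ (F : Module.Dual ℝ (GroupLieAlgebra 𝓘(ℝ, R7) G)) (a : Fin 7 → ℝ),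
      a = dualCoords e F →
      (orbitDim e F = 6 ↔ a 4 ≠ 0 ∧ a 1 ^ 2 + a 3 ^ 2 ≠ 0) ∧
      (a 1 * a 4 ≠ 0 → a 3 = 0 →
        coadjointOrbit F = dualCoords e ⁻¹'
          {x | x 3 = 0 ∧ 0 < a 1 * x 1 ∧ 0 < a 4 * x 4}) ∧
      (a 3 * a 4 ≠ 0 →
        coadjointOrbit F = dualCoords e ⁻¹'
          {x | x 2 - x 1 * x 4 / x 3 = (a 2 * a 3 - a 1 * a 4) / a 3 ∧
            0 < a 3 * x 3 ∧ 0 < a 4 * x 4} ∧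
        IsPartOfQuadric (dualCoords e '' coadjointOrbit F))) ∧
    -- the common part of the picture for `G₃`, `G₉` and `G₁₀^lam`
    ((K = .g3 ∨ K = .g9 ∨ ∃ lam : ℝ, K = .g10 lam) →
      ∀ (F : Module.Dual ℝ (GroupLieAlgebra 𝓘(ℝ, R7) G)) (a : Fin 7 → ℝ),
      a = dualCoords e F →
      (orbitDim e F = 6 ↔
        (a 3 = 0 ∧ a 1 * a 4 ≠ 0) ∨ (a 3 ≠ 0 ∧ a 2 ^ 2 + a 4 ^ 2 ≠ 0)) ∧
      (a 3 = 0 → a 1 * a 4 ≠ 0 →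
        coadjointOrbit F = dualCoords e ⁻¹'
          {x | x 3 = 0 ∧ 0 < a 1 * x 1 ∧ 0 < a 4 * x 4}) ∧
      (a 4 = 0 → a 2 * a 3 ≠ 0 →
        coadjointOrbit F = dualCoords e ⁻¹'
          {x | x 4 = 0 ∧ 0 < a 2 * x 2 ∧ 0 < a 3 * x 3})) ∧
    -- second type for `G₃`
    (K = .g3 → ∀ (F : Module.Dual ℝ (GroupLieAlgebra 𝓘(ℝ, R7) G)) (a : Fin 7 → ℝ),
      a = dualCoords e F → a 3 * a 4 ≠ 0 →
        coadjointOrbit F = dualCoords e ⁻¹'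
          {x | x 1 / x 3 - x 2 / x 4 = a 1 / a 3 - a 2 / a 4 ∧
            0 < a 3 * x 3 ∧ 0 < a 4 * x 4} ∧
        IsPartOfQuadric (dualCoords e '' coadjointOrbit F)) ∧
    -- second type for `G₉`
    (K = .g9 → ∀ (F : Module.Dual ℝ (GroupLieAlgebra 𝓘(ℝ, R7) G)) (a : Fin 7 → ℝ),
      a = dualCoords e F → a 3 * a 4 ≠ 0 →
        coadjointOrbit F = dualCoords e ⁻¹'
          {x | x 1 / x 3 - x 2 / x 4 + Real.log |x 3|
              = a 1 / a 3 - a 2 / a 4 + Real.log |a 3| ∧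
            0 < a 3 * x 3 ∧ 0 < a 4 * x 4} ∧
        IsTranscendentalSet (dualCoords e '' coadjointOrbit F)) ∧
    -- second type for `G₁₀^lam`
    (∀ lam : ℝ, K = .g10 lam →
      ∀ (F : Module.Dual ℝ (GroupLieAlgebra 𝓘(ℝ, R7) G)) (a : Fin 7 → ℝ),
      a = dualCoords e F → a 3 * a 4 ≠ 0 →
        coadjointOrbit F = dualCoords e ⁻¹'
          {x | x 1 / x 3 - x 2 / x 4 + Real.log (|x 4| / |x 3| ^ lam)
              = a 1 / a 3 - a 2 / a 4 + Real.log (|a 4| / |a 3| ^ lam) ∧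
            0 < a 3 * x 3 ∧ 0 < a 4 * x 4} ∧
        IsTranscendentalSet (dualCoords e '' coadjointOrbit F)) := by
  have hdim2 : K = .g2 → ∀ F, orbitDim e F = 6 ↔
      dualCoords e F 3 ≠ 0 ∧ dualCoords e F 2 ^ 2 + dualCoords e F 4 ^ 2 ≠ 0 := by
    rintro rfl F
    rw [orbitDim_eq, finrank_range_coadMap_g2_eq_six_iff]
  have hdim4 : K = .g4 → ∀ F, orbitDim e F = 6 ↔
      dualCoords e F 4 ≠ 0 ∧ dualCoords e F 1 ^ 2 + dualCoords e F 3 ^ 2 ≠ 0 := by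
    rintro rfl F
    rw [orbitDim_eq, finrank_range_coadMap_g4_eq_six_iff]
  have hdim3 : (K = .g3 ∨ K = .g9 ∨ ∃ lam : ℝ, K = .g10 lam) → ∀ F, orbitDim e F = 6 ↔
      (dualCoords e F 3 = 0 ∧ dualCoords e F 1 * dualCoords e F 4 ≠ 0) ∨
        (dualCoords e F 3 ≠ 0 ∧ dualCoords e F 2 ^ 2 + dualCoords e F 4 ^ 2 ≠ 0) := by
    rintro (rfl | rfl | ⟨lam, rfl⟩) F <;> rw [orbitDim_eq]
    · exact finrank_range_coadMap_g3_eq_six_iff _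
    · exact finrank_range_coadMap_g9_eq_six_iff _
    · exact finrank_range_coadMap_g10_eq_six_iff lam _
  refine ⟨⟨?_, ?_⟩, ?_, ?_, ?_, ?_, ?_, ?_⟩
  -- The form with all coordinates equal to `1` meets the nonvanishing conditions of every family.
  · obtain ⟨F, hF⟩ := dualCoords_surjective e fun _ => 1
    refine ⟨F, ?_⟩
    cases K with
    | g2 => rw [hdim2 rfl, hF]; norm_num
    | g4 => rw [hdim4 rfl, hF]; norm_num
    | g3 => rw [hdim3 (.inl rfl), hF]; norm_num
    | g9 => rw [hdim3 (.inr (.inl rfl)), hF]; norm_num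
    | g10 lam => rw [hdim3 (.inr (.inr ⟨lam, rfl⟩)), hF]; norm_num
  · rintro _ ⟨F, rfl⟩
    rw [orbitDim_eq]
    exact finrank_range_coadMap_le K _
  · rintro hK F a ha
    refine ⟨ha ▸ hdim2 hK F, ?_, ?_⟩ <;> subst hK
    · intro h h4
      subst ha
      exact coadjointOrbit_g2_of_eq_zero e h4 (left_ne_zero_of_mul h) (right_ne_zero_of_mul h)
    · intro h
      have hO := coadjointOrbit_g2 e ha (left_ne_zero_of_mul h) (right_ne_zero_of_mul h)
      refine ⟨hO, ?_⟩
      rw [hO, image_dualCoords_preimage]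
      -- Multiplying the equation of the orbit by `x 4` puts it in the shape of the quadric.
      refine isPartOfQuadric_of_forall (i := 4) (j := 1) (k := 3) (l := 2) (by decide)
        (by decide) (by decide) (by decide) (by decide) (-((a 1 * a 4 - a 2 * a 3) / a 4)) 0 ?_
      rintro x ⟨hx, -, h4⟩
      have h4' : x 4 ≠ 0 := right_ne_zero_of_mul h4.ne'
      rw [← hx]
      field_simp
      ring
  · rintro hK F a ha
    refine ⟨ha ▸ hdim4 hK F, ?_, ?_⟩ <;> subst hK
    · intro h h3
      subst ha
      exact coadjointOrbit_g4_of_eq_zero e h3 (left_ne_zero_of_mul h) (right_ne_zero_of_mul h)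
    · intro h
      have hO := coadjointOrbit_g4 e ha (left_ne_zero_of_mul h) (right_ne_zero_of_mul h)
      refine ⟨hO, ?_⟩
      rw [hO, image_dualCoords_preimage]
      refine isPartOfQuadric_of_forall (i := 3) (j := 2) (k := 1) (l := 4) (by decide)
        (by decide) (by decide) (by decide) (by decide) (-((a 2 * a 3 - a 1 * a 4) / a 3)) 0 ?_
      rintro x ⟨hx, h3, -⟩
      have h3' : x 3 ≠ 0 := right_ne_zero_of_mul h3.ne'
      rw [← hx]
      field_simp
      ring
  · rintro hK F a ha
    refine ⟨ha ▸ hdim3 hK F, ?_, ?_⟩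
    · intro h3 h
      subst ha
      have h1 := left_ne_zero_of_mul h
      have h4 := right_ne_zero_of_mul h
      rcases hK with rfl | rfl | ⟨lam, rfl⟩
      · exact coadjointOrbit_g3_of_eq_zero_left e h3 h1 h4
      · exact coadjointOrbit_g9_of_eq_zero_left e h3 h1 h4
      · exact coadjointOrbit_g10_of_eq_zero_left e h3 h1 h4
    · intro h4 h
      subst ha
      have h2 := left_ne_zero_of_mul h
      have h3 := right_ne_zero_of_mul h
      rcases hK with rfl | rfl | ⟨lam, rfl⟩
      · exact coadjointOrbit_g3_of_eq_zero_right e h4 h2 h3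
      · exact coadjointOrbit_g9_of_eq_zero_right e h4 h2 h3
      · exact coadjointOrbit_g10_of_eq_zero_right e h4 h2 h3
  · rintro rfl F a ha h
    have hO := coadjointOrbit_g3 e ha (left_ne_zero_of_mul h) (right_ne_zero_of_mul h)
    refine ⟨hO, ?_⟩
    rw [hO, image_dualCoords_preimage]
    refine isPartOfQuadric_of_forall (i := 4) (j := 1) (k := 3) (l := 2) (by decide)
      (by decide) (by decide) (by decide) (by decide) 0 (-(a 1 / a 3 - a 2 / a 4)) ?_
    rintro x ⟨hx, h3, h4⟩
    have h3' : x 3 ≠ 0 := right_ne_zero_of_mul h3.ne'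
    have h4' : x 4 ≠ 0 := right_ne_zero_of_mul h4.ne'
    rw [← hx]
    field_simp
    ring
  · rintro rfl F a ha h
    have h3 := left_ne_zero_of_mul h
    have h4 := right_ne_zero_of_mul h
    have hO := coadjointOrbit_g9 e ha h3 h4
    refine ⟨hO, ?_⟩
    rw [hO, image_dualCoords_preimage]
    exact isTranscendentalSet_g9 _ h3 h4
  · rintro lam rfl F a ha h
    have h3 := left_ne_zero_of_mul h
    have h4 := right_ne_zero_of_mul h
    have hO := coadjointOrbit_g10 e ha h3 h4
    refine ⟨hO, ?_⟩
    rw [hO, image_dualCoords_preimage]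
    exact isTranscendentalSet_g10 lam _ h3 h4
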